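/- Let $a_n>0$ and $b_n\in\mathbb{R}$ ($n\ge 1$) satisfy $$\sum_{n=1}^\infty n\bigl(|a_n-1|+|b_n|\bigr)<\infty ,$$ and let $p_n$ be the orthonormal polynomials with these Jacobi parameters, that is, $p_{-1}=0$, $p_0=1$ and $x p_n(x)=a_{n+1}p_{n+1}(x)+b_{n+1}p_n(x)+a_np_{n-1}(x)$ for $n\ge 0$. Put $a_0=1$. Then there is exactly one complex sequence $(u_n)_{n\ge 0}$ (the Jost solution at $x=2$) with $$a_nu_{n+1}+b_nu_n+a_{n-1}u_{n-1}=2u_n\quad (n\ge 1),\qquad \lim_{n\to\infty}u_n=1 .$$ Its value $u_0$ is the Jost function at $2$. Call $2$ a resonance if $u_0=0$, and nonresonant if $u_0\neq 0$. Let $0\le\theta_1^{(n)}<\theta_2^{(n)}<\cdots$ be the angles $\theta\in[0,\pi]$ for which $2\cos\theta$ is a zero of $p_n$, so that $2\cos\theta_1^{(n)}>2\cos\theta_2^{(n)}>\cdots$ are the zeros of $p_n$ in $[-2,2]$, listed downwards from $2$. Then for every fixed $j\ge 1$ the angle $\theta_j^{(n)}$ exists for all sufficiently large $n$, and: (a)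 if $2$ is a resonance, then $n\theta_j^{(n)}\to (j-\tfrac12)\pi$ as $n\to\infty$; (b) if $2$ is nonresonant, then $n\theta_j^{(n)}\to j\pi$ as $n\to\infty$. -/

import Mathlib

open Filter Topology

namespace OPRL

/-- The orthonormal polynomials `p_n` with Jacobi parameters `a_n, b_n` (`n ≥ 1`; the values
`a 0` and `b 0` are never used): `p_{-1} = 0`, `p_0 = 1`, and
`x p_n = a_{n+1} p_{n+1} + b_{n+1} p_n + a_n p_{n-1}`. -/
noncomputable def orthoPoly (a b : ℕ → ℝ) : ℕ → Polynomial ℝ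
  | 0 => 1
  | 1 => Polynomial.C (a 1)⁻¹ * (Polynomial.X - Polynomial.C (b 1))
  | n + 2 => Polynomial.C (a (n + 2))⁻¹ *
      ((Polynomial.X - Polynomial.C (b (n + 2))) * orthoPoly a b (n + 1)
        - Polynomial.C (a (n + 1)) * orthoPoly a b n)

/-- The off-diagonal parameters with the convention `a_0 = 1`. -/
def offDiag (a : ℕ → ℝ) (n : ℕ) : ℝ := if n = 0 then 1 else a n

/-- `u` is a Jost solution at the point `x = z + z⁻¹` of `[-2, 2]`, where `|z| = 1`:
`a_n u_{n+1} + b_n u_n + a_{n-1} u_{n-1} = x u_n` for all `n ≥ 1`, with `a_0 = 1`, and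
`z^{-n} u_n → 1`. The difference equation is written here at the index `n + 1`. -/
def IsJostSolution (a b : ℕ → ℝ) (z : ℂ) (u : ℕ → ℂ) : Prop :=
  (∀ n : ℕ, (offDiag a (n + 1) : ℂ) * u (n + 2) + (b (n + 1) : ℂ) * u (n + 1)
      + (offDiag a n : ℂ) * u n = (z + z⁻¹) * u (n + 1)) ∧
    Tendsto (fun n : ℕ => z⁻¹ ^ n * u n) atTop (𝓝 1)

/-- The Jost function: the value `u_0` of the Jost solution at `x = z + z⁻¹`
(arbitrary if there is no Jost solution). -/
noncomputable def jostFunction (a b : ℕ → ℝ) (z : ℂ) : ℂ :=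
  Classical.epsilon (IsJostSolution a b z) 0

/-- There is a resonance at `2`: the Jost function vanishes at `x = 2`, that is, at `z = 1`.
Otherwise `2` is nonresonant. -/
def IsResonantAtTwo (a b : ℕ → ℝ) : Prop := jostFunction a b 1 = 0

/-- The angles `θ ∈ [0, π]` for which `2 cos θ` is a zero of `p_n`. -/
def zeroAngles (a b : ℕ → ℝ) (n : ℕ) : Set ℝ :=
  {θ | θ ∈ Set.Icc 0 Real.pi ∧ (orthoPoly a b n).eval (2 * Real.cos θ) = 0}

/-- `t = θ_j^{(n)}` (used for `j ≥ 1`): the `j`-th smallest element of `zeroAngles a b n`, so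
that `2 cos t` is the `j`-th zero of `p_n` counted downwards from `2`. -/
def IsZeroAngle (a b : ℕ → ℝ) (n j : ℕ) (t : ℝ) : Prop :=
  t ∈ zeroAngles a b n ∧ {s ∈ zeroAngles a b n | s ≤ t}.ncard = j

end OPRL

/-! Near the edge `2` the polynomial `p_n`, viewed on the scale `x = 2 - t/(n+1)²`, looks like a
solution of the free equation. After division by `(n+1)^δ` it converges to `c cos √t` (resonance, `δ
= 0`) or to `c sin √t / √t` (no resonance, `δ = 1`), with `c ≠ 0`. The zeros of these limits in `t ≥
0` are the squares of `(i + 1/2)π` and `(i + 1)π`, `i ≥ 0`, and `t = (n+1)²(2 - 2 cos θ)` behaves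
like `(nθ)²`.

The convergence is proved coefficient by coefficient. The Taylor coefficients of `p_n` at `2` solve
the Jacobi equation at energy `2`, the order `m - 1` being the source for the order `m`
(`isSol_taylorCoeff`). The Wronskian with the Jost solution `u` reduces this equation to two
summations, so by Stolz–Cesàro each order grows by a factor `n²` (`IsSol.tendsto_div_pow`), and the
limits are `c/(2m+δ)!`. At order zero the Wronskian is the constant `u 0`: it gives linear growth if
`u 0 ≠ 0` and a nonzero limit if `u 0 = 0`.

A bound `C K^m / m!` uniform in `n` (`exists_abs_taylorCoeff_le`) upgrades this to locally uniform
convergence together with derivatives. As the limit zeros are simple and positive, the zeros in `t ≥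
0`, counted from `0`, converge (`eventually_exists_nth_zero`). -/

namespace OPRL

/-! ### The Jacobi equation at energy 2 and Wronskians -/

/-- `y` solves the inhomogeneous Jacobi equation at energy `2` with right-hand side `Φ`. -/
def IsSol (A B Φ y : ℕ → ℝ) : Prop :=
  ∀ n : ℕ, A (n + 1) * y (n + 2) + B (n + 1) * y (n + 1) + A n * y n = 2 * y (n + 1) + Φ (n + 1)

/-- The Wronskian (Casoratian) of two sequences. -/
def wronskian (A y u : ℕ → ℝ) (n : ℕ) : ℝ := A n * (y (n + 1) * u n - y n * u (n + 1))

/-- Cross-multiplying the two equations and subtracting cancels energy and potential; only the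
source survives. -/
lemma wronskian_succ {A B Φ y u : ℕ → ℝ} (hu : IsSol A B 0 u) (hy : IsSol A B Φ y) (n : ℕ) :
    wronskian A y u (n + 1) = wronskian A y u n + u (n + 1) * Φ (n + 1) := by
  have h1 := hu n
  have h2 := hy n
  simp only [Pi.zero_apply] at h1
  unfold wronskian
  linear_combination u (n + 1) * h2 - y (n + 1) * h1

/-- Reduction of order: together with `wronskian_succ` it recovers `y` from its source by two
successive summations. -/
lemma quotient_succ_sub {A y u : ℕ → ℝ} {n : ℕ} (hA : A n ≠ 0) (h0 : u n ≠ 0)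
    (h1 : u (n + 1) ≠ 0) :
    y (n + 1) / u (n + 1) - y n / u n = wronskian A y u n / (A n * u n * u (n + 1)) := by
  unfold wronskian
  field_simp

/-- A solution of the homogeneous equation that vanishes far out vanishes identically. -/
lemma IsSol.eq_zero_of_eventually {A B y : ℕ → ℝ} (hA : ∀ n, 0 < A n) (hy : IsSol A B 0 y)
    {N : ℕ} (hN : ∀ n, N ≤ n → y n = 0) : ∀ n, y n = 0 := by
  induction N with
  | zero => exact fun n => hN n (Nat.zero_le n)
  | succ N ih =>
    refine ih fun n hn => ?_
    rcases hn.eq_or_lt with rfl | h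
    · have := hy N
      rw [hN (N + 1) le_rfl, hN (N + 2) (by omega)] at this
      simpa [(hA N).ne'] using this
    · exact hN n h

/-- A solution far out extends to a solution. -/
lemma exists_isSol_extension {A B : ℕ → ℝ} (hA : ∀ n, 0 < A n) (N : ℕ) :
    ∀ u : ℕ → ℝ, (∀ n, N ≤ n →
      A (n + 1) * u (n + 2) + B (n + 1) * u (n + 1) + A n * u n = 2 * u (n + 1)) →
    ∃ v : ℕ → ℝ, IsSol A B 0 v ∧ ∀ n, N ≤ n → v n = u n := by
  induction N with
  | zero => exact fun u hu => ⟨u, fun n => by simpa using hu n (Nat.zero_le n), fun _ _ => rfl⟩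
  | succ N ih =>
    intro u hu
    obtain ⟨v, hv, hvu⟩ := ih (Function.update u N
      ((2 * u (N + 1) - A (N + 1) * u (N + 2) - B (N + 1) * u (N + 1)) / A N)) (by
        intro n hn
        rcases hn.eq_or_lt with rfl | h
        · have := (hA N).ne'
          simp only [Function.update_self, Function.update_of_ne (show N + 2 ≠ N by omega),
            Function.update_of_ne (show N + 1 ≠ N by omega)]
          field_simp
          ring
        · simp only [Function.update_of_ne (show n + 2 ≠ N by omega),
            Function.update_of_ne (show n + 1 ≠ N by omega),
            Function.update_of_ne (show n ≠ N by omega)]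
          exact hu n h)
    refine ⟨v, hv, fun n hn => ?_⟩
    rw [hvu n (by omega), Function.update_of_ne (by omega)]

/-! ### Existence and uniqueness of the Jost solution at energy 2 -/

/-- A linear summation equation with small kernel has a bounded solution. -/
lemma exists_bounded_solution {h : ℕ → ℕ → ℝ} {M : ℕ → ℝ} (hM : Summable M)
    (hM2 : ∑' k, M k ≤ 1 / 2) (hb : ∀ n k, |h n k| ≤ M k) :
    ∃ (u : ℕ → ℝ) (C : ℝ), (∀ n, |u n| ≤ C) ∧ ∀ n, u n = 1 - ∑' k, h n k * u k := by
  have hM0 : ∀ k, 0 ≤ M k := fun k => (abs_nonneg _).trans (hb 0 k)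
  have key : ∀ (f : ℕ → ℝ) (C : ℝ), (∀ k, |f k| ≤ C) → ∀ n,
      Summable (fun k => h n k * f k) ∧ |∑' k, h n k * f k| ≤ 1 / 2 * C := by
    intro f C hf n
    have hC : 0 ≤ C := (abs_nonneg _).trans (hf 0)
    have hle : ∀ k, ‖h n k * f k‖ ≤ M k * C := fun k => by
      rw [Real.norm_eq_abs, abs_mul]
      exact mul_le_mul (hb n k) (hf k) (abs_nonneg _) (hM0 k)
    have hs := (hM.mul_right C).of_norm_bounded hle
    refine ⟨hs, ?_⟩
    rw [← Real.norm_eq_abs]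
    refine (tsum_of_norm_bounded (hM.mul_right C).hasSum hle).trans ?_
    rw [tsum_mul_right]
    exact mul_le_mul_of_nonneg_right hM2 hC
  let T : BoundedContinuousFunction ℕ ℝ → BoundedContinuousFunction ℕ ℝ := fun f =>
    BoundedContinuousFunction.ofNormedAddCommGroupDiscrete
      (fun n => 1 - ∑' k, h n k * f k) (1 + 1 / 2 * ‖f‖) (fun n => by
        have := (key f ‖f‖ (fun k => f.norm_coe_le_norm k) n).2
        refine (norm_sub_le _ _).trans ?_
        simpa using this)
  have hT : ContractingWith (1 / 2) T := by
    refine ⟨by rw [← NNReal.coe_lt_coe]; norm_num, LipschitzWith.of_dist_le_mul fun f g => ?_⟩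
    rw [BoundedContinuousFunction.dist_le (by positivity)]
    intro n
    have hf := (key f ‖f‖ (fun k => f.norm_coe_le_norm k) n).1
    have hg := (key g ‖g‖ (fun k => g.norm_coe_le_norm k) n).1
    have := (key (fun k => g k - f k) (dist f g) (fun k => by
      have := BoundedContinuousFunction.dist_coe_le_dist (f := f) (g := g) k
      rwa [dist_comm, Real.dist_eq] at this) n).2
    have e : (T f) n - (T g) n = ∑' k, h n k * (g k - f k) := by
      change (1 - ∑' k, h n k * f k) - (1 - ∑' k, h n k * g k) = _
      simp only [mul_sub]
      rw [hg.tsum_sub hf]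
      ring
    rw [Real.dist_eq, e]
    simpa using this
  let u := ContractingWith.fixedPoint T hT
  have hu : T u = u := ContractingWith.fixedPoint_isFixedPt hT
  refine ⟨u, ‖u‖, fun n => u.norm_coe_le_norm n, fun n => ?_⟩
  conv_lhs => rw [← hu]
  rfl

lemma sum_Ico_sub_succ_bot (s : ℕ → ℝ) (n k : ℕ) :
    ∑ j ∈ Finset.Ico n k, s j - ∑ j ∈ Finset.Ico (n + 1) k, s j = if n < k then s n else 0 := by
  split_ifs with h
  · rw [Finset.sum_eq_sum_Ico_succ_bot h]; ring
  · rw [Finset.Ico_eq_empty (by omega), Finset.Ico_eq_empty (by omega)]; simp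

/-- Existence of the Jost solution at energy `2`. -/
lemma exists_jost {A B : ℕ → ℝ} (hA : ∀ n, 0 < A n) (hA1 : Tendsto A atTop (𝓝 1))
    (hv : Summable fun n : ℕ => ((n : ℝ) + 1) * |A (n + 1) + A n + B (n + 1) - 2|) :
    ∃ u : ℕ → ℝ, IsSol A B 0 u ∧ Tendsto u atTop (𝓝 1) := by
  obtain ⟨S, hS⟩ : ∃ S, ∀ n, (A n)⁻¹ ≤ S := by
    obtain ⟨S, hS⟩ := (hA1.inv₀ one_ne_zero).bddAbove_range
    exact ⟨S, fun n => hS ⟨n, rfl⟩⟩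
  have hS0 : 0 ≤ S := (inv_pos.2 (hA 0)).le.trans (hS 0)
  -- At `k = 0` the truncated subtraction gives a meaningless value, which the weight `k` removes.
  let v : ℕ → ℝ := fun k => A k + A (k - 1) + B k - 2
  have hv' : Summable fun k : ℕ => S * ((k : ℝ) * |v k|) := by
    refine Summable.mul_left _ ((summable_nat_add_iff 1).1 ?_)
    simpa [v] using hv
  obtain ⟨N, hN⟩ : ∃ N : ℕ, ∑' k : ℕ, (if N ≤ k then S * ((k : ℝ) * |v k|) else 0) ≤ 1 / 2 := by
    have : Tendsto (fun N : ℕ => ∑' k, (if N ≤ k then S * ((k : ℝ) * |v k|) else 0)) atTop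
        (𝓝 (∑' _ : ℕ, (0 : ℝ))) := by
      refine tendsto_tsum_of_dominated_convergence hv' (fun k => ?_)
        (Eventually.of_forall fun N k => ?_)
      · refine tendsto_const_nhds.congr' ?_
        filter_upwards [eventually_gt_atTop k] with N hN
        rw [if_neg (by omega)]
      · have : 0 ≤ S * ((k : ℝ) * |v k|) := by positivity
        split_ifs
        · rw [Real.norm_eq_abs, abs_of_nonneg this]
        · simpa using this
    rw [tsum_zero] at this
    exact (this.eventually (eventually_le_nhds (show (0 : ℝ) < 1 / 2 by norm_num))).exists
  -- Cutting the potential off below `N` makes the kernel small enough for a contraction. The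
  -- equation then holds only from `N` on, and the solution is extended backwards.
  let w : ℕ → ℝ := fun k => if N ≤ k then v k else 0
  let M : ℕ → ℝ := fun k => if N ≤ k then S * ((k : ℝ) * |v k|) else 0
  have hM : Summable M := by
    refine hv'.of_norm_bounded fun k => ?_
    have : 0 ≤ S * ((k : ℝ) * |v k|) := by positivity
    simp only [M]
    split_ifs
    · rw [Real.norm_eq_abs, abs_of_nonneg this]
    · simpa using this
  have hMw : ∀ k, M k = S * k * |w k| := fun k => by
    simp only [M, w]; split_ifs <;> simp [mul_assoc]
  -- Summing the equation twice from infinity gives this kernel. The inner sum has at most `k`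
  -- terms, which is why the first moment of the potential is needed.
  let h : ℕ → ℕ → ℝ := fun n k => (∑ j ∈ Finset.Ico n k, (A j)⁻¹) * w k
  have hb : ∀ n k, |h n k| ≤ M k := by
    intro n k
    have h0 : 0 ≤ ∑ j ∈ Finset.Ico n k, (A j)⁻¹ :=
      Finset.sum_nonneg fun j _ => (inv_pos.2 (hA j)).le
    have h1 : ∑ j ∈ Finset.Ico n k, (A j)⁻¹ ≤ S * k := by
      refine (Finset.sum_le_card_nsmul _ _ S fun j _ => hS j).trans ?_
      rw [Nat.card_Ico, nsmul_eq_mul, mul_comm]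
      exact mul_le_mul_of_nonneg_left (by exact_mod_cast Nat.sub_le k n) hS0
    rw [hMw]
    simp only [h]
    rw [abs_mul, abs_of_nonneg h0]
    exact mul_le_mul_of_nonneg_right h1 (abs_nonneg _)
  obtain ⟨u, C, hC, hu⟩ := exists_bounded_solution hM hN hb
  have hbu : ∀ n k, ‖h n k * u k‖ ≤ M k * C := fun n k => by
    rw [Real.norm_eq_abs, abs_mul]
    exact mul_le_mul (hb n k) (hC k) (abs_nonneg _) ((abs_nonneg _).trans (hb n k))
  have hsum : ∀ n, Summable fun k => h n k * u k := fun n =>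
    (hM.mul_right C).of_norm_bounded (hbu n)
  have hlim : Tendsto u atTop (𝓝 1) := by
    have : Tendsto (fun n => ∑' k, h n k * u k) atTop (𝓝 (∑' _ : ℕ, (0 : ℝ))) := by
      refine tendsto_tsum_of_dominated_convergence (hM.mul_right C) (fun k => ?_)
        (Eventually.of_forall hbu)
      refine tendsto_const_nhds.congr' ?_
      filter_upwards [eventually_ge_atTop k] with n hn
      simp [h, Finset.Ico_eq_empty (show ¬ n < k by omega)]
    rw [tsum_zero] at this
    have := this.const_sub 1
    rw [sub_zero] at this
    exact this.congr fun n => (hu n).symm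
  let T : ℕ → ℕ → ℝ := fun n k => if n < k then w k * u k else 0
  have hdiff : ∀ n k, h n k * u k - h (n + 1) k * u k = (A n)⁻¹ * T n k := by
    intro n k
    have := sum_Ico_sub_succ_bot (fun j => (A j)⁻¹) n k
    simp only [h, T]
    rw [← sub_mul, ← sub_mul, this]
    split_ifs <;> ring
  have hTs : ∀ n, Summable (T n) := fun n => by
    have := ((hsum n).sub (hsum (n + 1))).mul_left (A n)
    refine this.congr fun k => ?_
    rw [hdiff, mul_inv_cancel_left₀ (hA n).ne']
  have hD : ∀ n, A n * (u (n + 1) - u n) = ∑' k, T n k := by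
    intro n
    rw [hu n, hu (n + 1)]
    have : (1 - ∑' k, h (n + 1) k * u k) - (1 - ∑' k, h n k * u k)
        = (A n)⁻¹ * ∑' k, T n k := by
      rw [← tsum_mul_left, ← tsum_congr (hdiff n), (hsum n).tsum_sub (hsum (n + 1))]
      ring
    rw [this, mul_inv_cancel_left₀ (hA n).ne']
  have hDD : ∀ n, ∑' k, T n k - ∑' k, T (n + 1) k = w (n + 1) * u (n + 1) := by
    intro n
    rw [← (hTs n).tsum_sub (hTs (n + 1)), ← tsum_ite_eq (n + 1) (fun k => w k * u k)]
    refine tsum_congr fun k => ?_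
    simp only [T]
    rcases lt_trichotomy k (n + 1) with hk | hk | hk
    · rw [if_neg (by omega), if_neg (by omega), if_neg (by omega)]; simp
    · rw [if_pos (by omega), if_neg (by omega), if_pos hk]; simp
    · rw [if_pos (by omega), if_pos (by omega), if_neg (by omega)]; simp
  obtain ⟨y, hy, hyu⟩ := exists_isSol_extension (B := B) hA N u (by
    intro n hn
    have h1 := hD n
    have h2 := hD (n + 1)
    have h3 := hDD n
    have h4 : w (n + 1) = A (n + 1) + A n + B (n + 1) - 2 := by
      simp only [w, v]; rw [if_pos (by omega)]; simp
    rw [h4] at h3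
    rw [show n + 1 + 1 = n + 2 from rfl] at h2
    linear_combination h2 - h1 - h3)
  refine ⟨y, hy, hlim.congr' ?_⟩
  filter_upwards [eventually_ge_atTop N] with n hn using (hyu n hn).symm

/-- A solution that tends to zero vanishes if there is a solution that tends to one. -/
lemma IsSol.eq_zero_of_tendsto {A B u d : ℕ → ℝ} (hA : ∀ n, 0 < A n)
    (hA1 : Tendsto A atTop (𝓝 1)) (hu : IsSol A B 0 u) (hu1 : Tendsto u atTop (𝓝 1))
    (hd : IsSol A B 0 d) (hd0 : Tendsto d atTop (𝓝 0)) : ∀ n, d n = 0 := by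
  have hconst : ∀ n, wronskian A d u n = wronskian A d u 0 := by
    intro n
    induction n with
    | zero => rfl
    | succ n ih => rw [wronskian_succ hu hd, ih]; simp
  have hlim : Tendsto (wronskian A d u) atTop (𝓝 (1 * (0 * 1 - 0 * 1))) :=
    hA1.mul ((((tendsto_add_atTop_iff_nat 1).2 hd0).mul hu1).sub
      (hd0.mul ((tendsto_add_atTop_iff_nat 1).2 hu1)))
  have hW0 : wronskian A d u 0 = 0 := by
    have h := tendsto_nhds_unique (tendsto_const_nhds.congr fun n => (hconst n).symm) hlim
    simpa using h
  obtain ⟨N, hN⟩ := eventually_atTop.1 (hu1.eventually_ne one_ne_zero)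
  -- Zero Wronskian means that `d` is far out a constant multiple of `u`; the limits `0` and `1`
  -- force the constant to be `0`.
  have hquot : ∀ n, N ≤ n → d n / u n = d N / u N := by
    intro n hn
    induction n, hn using Nat.le_induction with
    | base => rfl
    | succ n hn ih =>
      have := quotient_succ_sub (y := d) (hA n).ne' (hN n hn) (hN (n + 1) (by omega))
      rw [hconst, hW0, zero_div] at this
      linarith
  have hq : Tendsto (fun n => d n / u n) atTop (𝓝 (0 / 1)) := hd0.div hu1 one_ne_zero
  have hq0 : d N / u N = 0 := by
    refine (tendsto_nhds_unique (tendsto_const_nhds.congr' ?_) hq).trans (zero_div 1)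
    filter_upwards [eventually_ge_atTop N] with n hn using (hquot n hn).symm
  refine hd.eq_zero_of_eventually hA (N := N) fun n hn => ?_
  have := hquot n hn
  rw [hq0, div_eq_zero_iff] at this
  exact this.resolve_right (hN n hn)

end OPRL

namespace OPRL

/-! ### Consequences of the summability hypothesis; the Jost function -/

lemma offDiag_pos {a : ℕ → ℝ} (ha : ∀ n : ℕ, 1 ≤ n → 0 < a n) (n : ℕ) : 0 < offDiag a n := by
  unfold offDiag
  split_ifs with h
  · exact one_pos
  · exact ha n (by omega)

/-- The weight `n` gives no control at `n = 0`, but there the convention `a_0 = 1` makes the term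
vanish. -/
lemma abs_offDiag_sub_one_le (a : ℕ → ℝ) (n : ℕ) :
    |offDiag a n - 1| ≤ n * |offDiag a n - 1| := by
  rcases Nat.eq_zero_or_pos n with rfl | h
  · simp [offDiag]
  · exact le_mul_of_one_le_left (abs_nonneg _) (by exact_mod_cast h)

lemma summable_mul_abs_offDiag {a b : ℕ → ℝ}
    (hab : Summable fun n : ℕ => (n : ℝ) * (|a n - 1| + |b n|)) :
    Summable fun n : ℕ => (n : ℝ) * |offDiag a n - 1| := by
  refine hab.of_norm_bounded fun n => ?_
  rw [Real.norm_eq_abs, abs_of_nonneg (by positivity)]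
  rcases Nat.eq_zero_or_pos n with rfl | h
  · simp
  · rw [offDiag, if_neg (by omega)]
    gcongr
    exact le_add_of_nonneg_right (abs_nonneg _)

lemma tendsto_offDiag {a b : ℕ → ℝ}
    (hab : Summable fun n : ℕ => (n : ℝ) * (|a n - 1| + |b n|)) :
    Tendsto (offDiag a) atTop (𝓝 1) := by
  have := squeeze_zero (fun n => abs_nonneg _) (abs_offDiag_sub_one_le a)
    (summable_mul_abs_offDiag hab).tendsto_atTop_zero
  rw [tendsto_iff_dist_tendsto_zero]
  simpa [Real.dist_eq] using this

lemma summable_potential {a b : ℕ → ℝ}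
    (hab : Summable fun n : ℕ => (n : ℝ) * (|a n - 1| + |b n|)) :
    Summable fun n : ℕ => ((n : ℝ) + 1) *
      |offDiag a (n + 1) + offDiag a n + b (n + 1) - 2| := by
  have h1 := summable_mul_abs_offDiag hab
  have h2 := (summable_nat_add_iff 1).2 h1
  have h3 : Summable fun n : ℕ => (n : ℝ) * |b n| := hab.of_norm_bounded fun n => by
    rw [Real.norm_eq_abs, abs_of_nonneg (by positivity)]
    gcongr
    exact le_add_of_nonneg_left (abs_nonneg _)
  have h4 := (summable_nat_add_iff 1).2 h3
  refine ((h2.add (h1.mul_left 2)).add h4).of_norm_bounded fun n => ?_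
  rw [Real.norm_eq_abs, abs_of_nonneg (by positivity)]
  -- This turns the weight `n + 1` on `|a_n - 1|` into `2n`, the origin of the factor `2` above.
  have e := abs_offDiag_sub_one_le a n
  have t : |offDiag a (n + 1) + offDiag a n + b (n + 1) - 2|
      ≤ |offDiag a (n + 1) - 1| + |offDiag a n - 1| + |b (n + 1)| := by
    rw [show offDiag a (n + 1) + offDiag a n + b (n + 1) - 2
      = (offDiag a (n + 1) - 1) + (offDiag a n - 1) + b (n + 1) by ring]
    exact abs_add_three _ _ _
  push_cast
  nlinarith [mul_le_mul_of_nonneg_left t (by positivity : (0 : ℝ) ≤ (n : ℝ) + 1)]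

lemma isJostSolution_ofReal {a b u : ℕ → ℝ} (hu : IsSol (offDiag a) b 0 u)
    (hu1 : Tendsto u atTop (𝓝 1)) : IsJostSolution a b 1 (fun n => (u n : ℂ)) := by
  refine ⟨fun n => ?_, ?_⟩
  · have := congrArg (fun r : ℝ => (r : ℂ)) (hu n)
    simp only [Pi.zero_apply, add_zero] at this
    push_cast at this
    rw [this]
    norm_num
  · have := (Complex.continuous_ofReal.tendsto 1).comp hu1
    simpa [Function.comp_def] using this

/-- The Jost solution at `2` is unique, and it is the given real one. -/
lemma IsJostSolution.eq_ofReal {a b u : ℕ → ℝ} (ha : ∀ n, 0 < offDiag a n)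
    (ha1 : Tendsto (offDiag a) atTop (𝓝 1)) (hu : IsSol (offDiag a) b 0 u)
    (hu1 : Tendsto u atTop (𝓝 1)) {v : ℕ → ℂ} (hv : IsJostSolution a b 1 v) :
    v = fun n => (u n : ℂ) := by
  obtain ⟨hv, hv1⟩ := hv
  simp only [inv_one, one_pow, one_mul] at hv1
  have hre : ∀ n, (v n).re - u n = 0 := by
    refine IsSol.eq_zero_of_tendsto ha ha1 hu hu1 (fun n => ?_) ?_
    · have h1 := congrArg Complex.re (hv n)
      have h2 := hu n
      norm_num at h1 h2 ⊢
      linarith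
    · simpa using ((Complex.continuous_re.tendsto 1).comp hv1).sub hu1
  have him : ∀ n, (v n).im = 0 := by
    refine IsSol.eq_zero_of_tendsto ha ha1 hu hu1 (fun n => ?_) ?_
    · have h1 := congrArg Complex.im (hv n)
      norm_num at h1 ⊢
      linarith
    · simpa [Function.comp_def] using (Complex.continuous_im.tendsto 1).comp hv1
  funext n
  exact Complex.ext (by simpa using sub_eq_zero.1 (hre n)) (by simpa using him n)

/-- `Classical.epsilon` chooses some Jost solution because one exists, and uniqueness identifies it
with the real one. -/
lemma jostFunction_eq_ofReal {a b u : ℕ → ℝ} (ha : ∀ n, 0 < offDiag a n)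
    (ha1 : Tendsto (offDiag a) atTop (𝓝 1)) (hu : IsSol (offDiag a) b 0 u)
    (hu1 : Tendsto u atTop (𝓝 1)) : jostFunction a b 1 = (u 0 : ℂ) := by
  have h : IsJostSolution a b 1 (Classical.epsilon (IsJostSolution a b 1)) :=
    Classical.epsilon_spec ⟨_, isJostSolution_ofReal hu hu1⟩
  unfold jostFunction
  rw [h.eq_ofReal ha ha1 hu hu1]

/-! ### Taylor coefficients of the orthonormal polynomials at 2 -/

/-- The Taylor coefficients at `2` of the orthonormal polynomials, with the degree shifted by one
so that `p_{-1} = 0` is at the index `0`. -/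
noncomputable def taylorCoeff (a b : ℕ → ℝ) (m : ℕ) : ℕ → ℝ
  | 0 => 0
  | n + 1 => (Polynomial.taylor 2 (orthoPoly a b n)).coeff m

/-- `taylorCoeff` at the previous order, zero for order zero. -/
noncomputable def prevTaylorCoeff (a b : ℕ → ℝ) : ℕ → ℕ → ℝ
  | 0 => 0
  | m + 1 => taylorCoeff a b m

lemma natDegree_orthoPoly_le (a b : ℕ → ℝ) (n : ℕ) : (orthoPoly a b n).natDegree ≤ n := by
  induction n using Nat.strong_induction_on with
  | _ n ih =>
    match n with
    | 0 => simp [orthoPoly]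
    | 1 =>
      rw [orthoPoly]
      refine (Polynomial.natDegree_C_mul_le _ _).trans (Polynomial.natDegree_X_sub_C_le _)
    | n + 2 =>
      rw [orthoPoly]
      refine (Polynomial.natDegree_C_mul_le _ _).trans ?_
      refine (Polynomial.natDegree_sub_le _ _).trans (max_le ?_ ?_)
      · refine Polynomial.natDegree_mul_le.trans ?_
        have := ih (n + 1) (by omega)
        have := Polynomial.natDegree_X_sub_C_le (b (n + 2))
        omega
      · refine (Polynomial.natDegree_C_mul_le _ _).trans ?_
        have := ih n (by omega)
        omega

lemma taylorCoeff_eq_zero (a b : ℕ → ℝ) {m n : ℕ} (h : n ≤ m) : taylorCoeff a b m n = 0 := by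
  match n with
  | 0 => rfl
  | n + 1 =>
    refine Polynomial.coeff_eq_zero_of_natDegree_lt ?_
    change (Polynomial.taylor 2 (orthoPoly a b n)).natDegree < m
    rw [Polynomial.natDegree_taylor]
    exact (natDegree_orthoPoly_le a b n).trans_lt h

lemma coeff_taylor_X_sub_C_mul (p : Polynomial ℝ) (c : ℝ) (m : ℕ) :
    (Polynomial.taylor 2 ((Polynomial.X - Polynomial.C c) * p)).coeff m
      = (2 - c) * (Polynomial.taylor 2 p).coeff m
        + (if m = 0 then 0 else (Polynomial.taylor 2 p).coeff (m - 1)) := by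
  have e : Polynomial.taylor 2 ((Polynomial.X - Polynomial.C c) * p)
      = Polynomial.C (2 - c) * Polynomial.taylor 2 p + Polynomial.X * Polynomial.taylor 2 p := by
    rw [Polynomial.taylor_mul, map_sub, Polynomial.taylor_X, Polynomial.taylor_C, map_sub]
    ring
  rw [e, Polynomial.coeff_add, Polynomial.coeff_C_mul]
  cases m <;> simp

/-- Write `x = 2 + (x - 2)` in the recurrence: multiplication by `x - 2` shifts Taylor coefficients
by one order, which produces the source. The shifted index lets the equation hold from the start
with `p_{-1} = 0`. -/
lemma isSol_taylorCoeff {a : ℕ → ℝ} (b : ℕ → ℝ) (ha : ∀ n : ℕ, 1 ≤ n → 0 < a n) (m : ℕ) :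
    IsSol (offDiag a) b (prevTaylorCoeff a b m) (taylorCoeff a b m) := by
  have hprev : ∀ n, prevTaylorCoeff a b m (n + 1) =
      if m = 0 then 0 else (Polynomial.taylor 2 (orthoPoly a b n)).coeff (m - 1) := by
    intro n; cases m <;> simp [prevTaylorCoeff, taylorCoeff]
  intro n
  rw [hprev]
  match n with
  | 0 =>
    have h1 := (ha 1 le_rfl).ne'
    have e := coeff_taylor_X_sub_C_mul 1 (b 1) m
    rw [mul_one] at e
    simp only [taylorCoeff, orthoPoly, Polynomial.taylor_mul, Polynomial.taylor_C,
      Polynomial.coeff_C_mul, e, offDiag]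
    simp only [zero_add, one_ne_zero, if_false]
    field_simp
    ring
  | n + 1 =>
    have h1 := (ha (n + 2) (by omega)).ne'
    simp only [taylorCoeff]
    rw [show n + 1 + 1 = n + 2 from rfl, orthoPoly, Polynomial.taylor_mul, Polynomial.taylor_C,
      Polynomial.coeff_C_mul, map_sub, Polynomial.coeff_sub, coeff_taylor_X_sub_C_mul,
      Polynomial.taylor_mul, Polynomial.taylor_C, Polynomial.coeff_C_mul]
    simp only [offDiag, if_neg (show n + 2 ≠ 0 by omega), if_neg (show n + 1 ≠ 0 by omega)]
    field_simp
    ring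

/-! ### Power growth of solutions by Stolz–Cesàro -/

lemma tendsto_succ_pow_sub_pow_div (p : ℕ) :
    Tendsto (fun n : ℕ => (((n : ℝ) + 1) ^ (p + 1) - (n : ℝ) ^ (p + 1)) / (n : ℝ) ^ p) atTop
      (𝓝 ((p : ℝ) + 1)) := by
  have hone : Tendsto (fun n : ℕ => ((n : ℝ) + 1) / n) atTop (𝓝 1) := by
    have := (tendsto_const_div_atTop_nhds_zero_nat (1 : ℝ)).const_add 1
    rw [add_zero] at this
    refine this.congr' ?_
    filter_upwards [eventually_gt_atTop 0] with n hn
    have : (n : ℝ) ≠ 0 := by positivity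
    field_simp
  induction p with
  | zero => simp
  | succ p ih =>
    have := (hone.mul ih).add_const 1
    rw [one_mul] at this
    push_cast
    refine this.congr' ?_
    filter_upwards [eventually_gt_atTop 0] with n hn
    have : (n : ℝ) ≠ 0 := by positivity
    field_simp
    ring

/-- Stolz–Cesàro for polynomial growth. -/
lemma tendsto_div_pow_succ {x : ℕ → ℝ} {p : ℕ} {L : ℝ}
    (h : Tendsto (fun n : ℕ => (x (n + 1) - x n) / (n : ℝ) ^ p) atTop (𝓝 L)) :
    Tendsto (fun n : ℕ => x n / (n : ℝ) ^ (p + 1)) atTop (𝓝 (L / (p + 1))) := by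
  let g : ℕ → ℝ := fun n => ((n : ℝ) + 1) ^ (p + 1) - (n : ℝ) ^ (p + 1)
  have hgpos : ∀ n, 0 < g n := fun n =>
    sub_pos.2 (pow_lt_pow_left₀ (by linarith) (Nat.cast_nonneg n) (by omega))
  have hgsum : ∀ n, ∑ i ∈ Finset.range n, g i = (n : ℝ) ^ (p + 1) := by
    intro n
    have := Finset.sum_range_sub (fun i : ℕ => (i : ℝ) ^ (p + 1)) n
    simpa [g] using this
  have htop : Tendsto (fun n : ℕ => (n : ℝ) ^ (p + 1)) atTop atTop :=
    (tendsto_pow_atTop (by omega)).comp tendsto_natCast_atTop_atTop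
  have hp : (p : ℝ) + 1 ≠ 0 := by positivity
  have hlim : Tendsto (fun n => (x (n + 1) - x n) / g n) atTop (𝓝 (L / (p + 1))) := by
    refine (h.div (tendsto_succ_pow_sub_pow_div p) hp).congr' ?_
    filter_upwards [eventually_gt_atTop 0] with n hn
    have : (n : ℝ) ^ p ≠ 0 := by positivity
    exact div_div_div_cancel_right₀ this _ _
  set L' := L / ((p : ℝ) + 1)
  -- The increments deviate from `L' * g` by `o(g)`, and the partial sums of `g` diverge, so the
  -- summed deviation is `o(n^(p+1))`.
  have ho : (fun n => (x (n + 1) - x n) - L' * g n) =o[atTop] g := by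
    rw [Asymptotics.isLittleO_iff_tendsto' (Eventually.of_forall fun n hn =>
      absurd hn (hgpos n).ne')]
    have := hlim.sub_const L'
    rw [sub_self] at this
    refine this.congr fun n => ?_
    rw [sub_div _ (L' * g n), mul_div_cancel_right₀ _ (hgpos n).ne']
  have hsum := ho.sum_range (fun n => (hgpos n).le) (by simpa only [hgsum] using htop)
  have hsum' := hsum.tendsto_div_nhds_zero
  have e : ∀ n, ∑ i ∈ Finset.range n, (x (i + 1) - x i - L' * g i)
      = x n - x 0 - L' * (n : ℝ) ^ (p + 1) := fun n => by
    rw [Finset.sum_sub_distrib, Finset.sum_range_sub, ← Finset.mul_sum, hgsum]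
  simp only [e, hgsum] at hsum'
  have h0 : Tendsto (fun n : ℕ => x 0 / (n : ℝ) ^ (p + 1)) atTop (𝓝 0) :=
    tendsto_const_nhds.div_atTop htop
  have := (hsum'.add h0).add_const L'
  rw [add_zero, zero_add] at this
  refine this.congr' ?_
  filter_upwards [eventually_gt_atTop 0] with n hn
  have : (n : ℝ) ≠ 0 := by positivity
  field_simp
  ring

lemma tendsto_succ_div_pow {x : ℕ → ℝ} {p : ℕ} {L : ℝ}
    (h : Tendsto (fun n : ℕ => x n / (n : ℝ) ^ p) atTop (𝓝 L)) :
    Tendsto (fun n : ℕ => x (n + 1) / (n : ℝ) ^ p) atTop (𝓝 L) := by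
  have hone : Tendsto (fun n : ℕ => (1 + 1 / (n : ℝ)) ^ p) atTop (𝓝 1) := by
    have := ((tendsto_const_div_atTop_nhds_zero_nat (1 : ℝ)).const_add 1).pow p
    simpa using this
  have := ((tendsto_add_atTop_iff_nat 1).2 h).mul hone
  rw [mul_one] at this
  refine this.congr' ?_
  filter_upwards [eventually_gt_atTop 0] with n hn
  have : (n : ℝ) ≠ 0 := by positivity
  rw [show 1 + 1 / (n : ℝ) = ((n : ℝ) + 1) / n by field_simp, div_pow]
  push_cast
  field_simp

/-- A solution whose Wronskian with the Jost solution grows like a power grows one power faster. -/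
lemma tendsto_div_pow_of_wronskian {A u y : ℕ → ℝ} (hA : ∀ n, 0 < A n)
    (hA1 : Tendsto A atTop (𝓝 1)) (hu1 : Tendsto u atTop (𝓝 1)) {p : ℕ} {L : ℝ}
    (hW : Tendsto (fun n : ℕ => wronskian A y u n / (n : ℝ) ^ p) atTop (𝓝 L)) :
    Tendsto (fun n : ℕ => y n / (n : ℝ) ^ (p + 1)) atTop (𝓝 (L / (p + 1))) := by
  have hu1' := (tendsto_add_atTop_iff_nat 1).2 hu1
  have hne := hu1.eventually_ne one_ne_zero
  have hne' := hu1'.eventually_ne one_ne_zero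
  have hr : Tendsto (fun n : ℕ => y n / u n / (n : ℝ) ^ (p + 1)) atTop (𝓝 (L / (p + 1))) := by
    refine tendsto_div_pow_succ (x := fun n => y n / u n) ?_
    have := hW.div ((hA1.mul hu1).mul hu1') (by norm_num)
    norm_num at this
    refine this.congr' ?_
    filter_upwards [hne, hne'] with n h0 h1
    rw [quotient_succ_sub (hA n).ne' h0 h1, div_right_comm]
    rfl
  have := hr.mul hu1
  rw [mul_one] at this
  refine this.congr' ?_
  filter_upwards [hne] with n h0
  field_simp

/-- Solutions whose right-hand side grows like a power grow two powers faster. -/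
lemma IsSol.tendsto_div_pow {A B u y Φ : ℕ → ℝ} (hA : ∀ n, 0 < A n)
    (hA1 : Tendsto A atTop (𝓝 1)) (hu : IsSol A B 0 u) (hu1 : Tendsto u atTop (𝓝 1))
    (hy : IsSol A B Φ y) {p : ℕ} {L : ℝ}
    (hΦ : Tendsto (fun n : ℕ => Φ n / (n : ℝ) ^ p) atTop (𝓝 L)) :
    Tendsto (fun n : ℕ => y n / (n : ℝ) ^ (p + 2)) atTop (𝓝 (L / (p + 1) / (p + 2))) := by
  have hW : Tendsto (fun n : ℕ => wronskian A y u n / (n : ℝ) ^ (p + 1)) atTop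
      (𝓝 (L / (p + 1))) := by
    refine tendsto_div_pow_succ ?_
    have := ((tendsto_add_atTop_iff_nat 1).2 hu1).mul (tendsto_succ_div_pow hΦ)
    rw [one_mul] at this
    refine this.congr fun n => ?_
    rw [wronskian_succ hu hy]
    ring
  have := tendsto_div_pow_of_wronskian hA hA1 hu1 hW
  push_cast at this
  rwa [add_assoc (p : ℝ), one_add_one_eq_two] at this

lemma taylorCoeff_zero_one (a b : ℕ → ℝ) (m : ℕ) :
    taylorCoeff a b m 1 = if m = 0 then 1 else 0 := by
  simp only [taylorCoeff, orthoPoly, Polynomial.taylor_one]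
  exact Polynomial.coeff_C

lemma wronskian_taylorCoeff_zero (a b u : ℕ → ℝ) (m : ℕ) :
    wronskian (offDiag a) (taylorCoeff a b m) u 0 = if m = 0 then u 0 else 0 := by
  rw [wronskian, taylorCoeff_zero_one]
  split_ifs <;> simp [offDiag, taylorCoeff]

/-- Order zero has no source, so the Wronskian keeps its value at index `0`. This is where the Jost
function enters the growth of `p_n(2)`. -/
lemma wronskian_taylorCoeff_order_zero {a b u : ℕ → ℝ} (ha : ∀ n : ℕ, 1 ≤ n → 0 < a n)
    (hu : IsSol (offDiag a) b 0 u) (n : ℕ) :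
    wronskian (offDiag a) (taylorCoeff a b 0) u n = u 0 := by
  induction n with
  | zero => simp [wronskian_taylorCoeff_zero]
  | succ n ih =>
    rw [wronskian_succ hu (isSol_taylorCoeff b ha 0), ih]
    simp [prevTaylorCoeff]

/-- Growth of `p_n(2)` in the nonresonant case. -/
lemma tendsto_taylorCoeff_zero_of_ne {a b u : ℕ → ℝ} (ha : ∀ n : ℕ, 1 ≤ n → 0 < a n)
    (ha1 : Tendsto (offDiag a) atTop (𝓝 1)) (hu : IsSol (offDiag a) b 0 u)
    (hu1 : Tendsto u atTop (𝓝 1)) :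
    Tendsto (fun n : ℕ => taylorCoeff a b 0 n / (n : ℝ) ^ 1) atTop (𝓝 (u 0)) := by
  have := tendsto_div_pow_of_wronskian (p := 0) (L := u 0) (y := taylorCoeff a b 0)
    (offDiag_pos ha) ha1 hu1 (by simp [wronskian_taylorCoeff_order_zero ha hu])
  simpa using this

/-- In the resonant case `p_n(2)` has a nonzero limit. -/
lemma tendsto_taylorCoeff_zero_of_eq {a b u : ℕ → ℝ} (ha : ∀ n : ℕ, 1 ≤ n → 0 < a n)
    (hu : IsSol (offDiag a) b 0 u)
    (hu1 : Tendsto u atTop (𝓝 1)) (hu0 : u 0 = 0) :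
    ∃ c : ℝ, c ≠ 0 ∧ Tendsto (fun n : ℕ => taylorCoeff a b 0 n / (n : ℝ) ^ 0) atTop (𝓝 c) := by
  obtain ⟨N, hN⟩ := eventually_atTop.1 (hu1.eventually_ne one_ne_zero)
  set y := taylorCoeff a b 0
  have hquot : ∀ n, N ≤ n → y n = y N / u N * u n := by
    intro n hn
    rw [← div_eq_iff (hN n hn)]
    induction n, hn using Nat.le_induction with
    | base => rfl
    | succ n hn ih =>
      have := quotient_succ_sub (y := y) (offDiag_pos ha n).ne' (hN n hn) (hN (n + 1) (by omega))
      rw [wronskian_taylorCoeff_order_zero ha hu, hu0, zero_div] at this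
      linarith
  refine ⟨y N / u N, fun h => ?_, ?_⟩
  -- A zero constant would make the solution vanish identically, contrary to `p_0 = 1`.
  · have := IsSol.eq_zero_of_eventually (offDiag_pos ha) (isSol_taylorCoeff b ha 0) (N := N)
      (fun n hn => (hquot n hn).trans (by rw [h, zero_mul])) 1
    rw [taylorCoeff_zero_one] at this
    simp at this
  · have := hu1.const_mul (y N / u N)
    rw [mul_one] at this
    refine this.congr' ?_
    filter_upwards [eventually_ge_atTop N] with n hn
    rw [hquot n hn, pow_zero, div_one]

/-- Growth of the Taylor coefficients of all orders. -/
lemma tendsto_taylorCoeff {a b u : ℕ → ℝ} (ha : ∀ n : ℕ, 1 ≤ n → 0 < a n)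
    (ha1 : Tendsto (offDiag a) atTop (𝓝 1)) (hu : IsSol (offDiag a) b 0 u)
    (hu1 : Tendsto u atTop (𝓝 1)) {δ : ℕ} (hδ : δ ≤ 1) {c : ℝ}
    (h0 : Tendsto (fun n : ℕ => taylorCoeff a b 0 n / (n : ℝ) ^ δ) atTop (𝓝 c)) (m : ℕ) :
    Tendsto (fun n : ℕ => taylorCoeff a b m n / (n : ℝ) ^ (2 * m + δ)) atTop
      (𝓝 (c / ((2 * m + δ).factorial : ℝ))) := by
  induction m with
  | zero =>
    have : (δ.factorial : ℝ) = 1 := by interval_cases δ <;> simp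
    simpa [this] using h0
  | succ m ih =>
    have := IsSol.tendsto_div_pow (offDiag_pos ha) ha1 hu hu1 (isSol_taylorCoeff b ha (m + 1)) ih
    convert this using 2
    · rw [show 2 * (m + 1) + δ = 2 * m + δ + 2 by ring]
    · rw [show 2 * (m + 1) + δ = 2 * m + δ + 1 + 1 by ring, Nat.factorial_succ, Nat.factorial_succ]
      push_cast
      have : ((2 * m + δ).factorial : ℝ) ≠ 0 := by positivity
      field_simp
      ring

/-! ### A bound on the Taylor coefficients uniform in the order -/

lemma sum_range_pow_le (p n : ℕ) :
    ((p : ℝ) + 1) * ∑ i ∈ Finset.range n, (i : ℝ) ^ p ≤ (n : ℝ) ^ (p + 1) := by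
  induction n with
  | zero => simp
  | succ n ih =>
    rw [Finset.sum_range_succ, mul_add]
    have key : (n : ℝ) ^ (p + 1) + (p + 1) * (n : ℝ) ^ p ≤ ((n : ℝ) + 1) ^ (p + 1) := by
      have h := pow_add_mul_le_add_pow (a := (n : ℝ)) (b := 1) (by positivity) (by positivity)
        (p + 1)
      simpa using h
    push_cast
    linarith

/-- A bound on the Taylor coefficients, uniform in the order. -/
lemma exists_abs_taylorCoeff_le {a b u : ℕ → ℝ} (ha : ∀ n : ℕ, 1 ≤ n → 0 < a n)
    (ha1 : Tendsto (offDiag a) atTop (𝓝 1)) (hu : IsSol (offDiag a) b 0 u)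
    (hu1 : Tendsto u atTop (𝓝 1)) {δ : ℕ} {l : ℕ → ℝ}
    (h : ∀ m, Tendsto (fun n : ℕ => taylorCoeff a b m n / (n : ℝ) ^ (2 * m + δ)) atTop
      (𝓝 (l m))) :
    ∃ C K : ℝ, 0 ≤ C ∧ 0 ≤ K ∧ ∀ m n : ℕ,
      |taylorCoeff a b m n| ≤ C * K ^ m / (m.factorial : ℝ) * (n : ℝ) ^ (2 * m + δ) := by
  set ψ := taylorCoeff a b
  have hev := (hu1.eventually (eventually_ge_nhds (show (1 / 2 : ℝ) < 1 by norm_num))).and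
    (ha1.eventually (eventually_ge_nhds (show (1 / 2 : ℝ) < 1 by norm_num)))
  obtain ⟨N, hN⟩ := eventually_atTop.1 hev
  obtain ⟨U, hU1, hU⟩ : ∃ U : ℝ, 1 ≤ U ∧ ∀ n, |u n| ≤ U := by
    obtain ⟨U, hU⟩ := hu1.abs.bddAbove_range
    exact ⟨max 1 U, le_max_left _ _, fun n => (hU ⟨n, rfl⟩).trans (le_max_right _ _)⟩
  have hS0 : ∀ m n, 0 ≤ ∑ i ∈ Finset.range n, |ψ m i| := fun m n =>
    Finset.sum_nonneg fun i _ => abs_nonneg _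
  -- For `m + 1 ≥ N` the coefficient of order `m + 1` vanishes at all indices up to `N`, so the
  -- quotient by `u` is summed from zero, within the range where `A, u ≥ 1/2`. The constant `8`
  -- bounds `1/(A u u)` and does not depend on `m`.
  have hstep : ∀ m, N ≤ m + 1 → ∀ n,
      |ψ (m + 1) n| ≤ 8 * U ^ 2 * n * ∑ i ∈ Finset.range n, |ψ m i| := by
    intro m hm
    have hW : ∀ n, |wronskian (offDiag a) (ψ (m + 1)) u n|
        ≤ U * ∑ i ∈ Finset.range (n + 1), |ψ m i| := by
      intro n
      induction n with
      | zero =>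
        rw [wronskian_taylorCoeff_zero, if_neg (by omega), abs_zero]
        exact mul_nonneg (by positivity) (hS0 _ _)
      | succ n ih =>
        rw [wronskian_succ hu (isSol_taylorCoeff b ha (m + 1)), Finset.sum_range_succ _ (n + 1),
          mul_add]
        refine (abs_add_le _ _).trans (add_le_add ih ?_)
        rw [abs_mul]
        exact mul_le_mul_of_nonneg_right (hU _) (abs_nonneg _)
    have hr : ∀ n, N ≤ n →
        |ψ (m + 1) n / u n| ≤ 8 * U * n * ∑ i ∈ Finset.range n, |ψ m i| := by
      intro n hn
      induction n, hn using Nat.le_induction with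
      | base =>
        rw [show ψ (m + 1) N = 0 from taylorCoeff_eq_zero a b hm, zero_div, abs_zero]
        exact mul_nonneg (by positivity) (hS0 _ _)
      | succ n hn ih =>
        have h0 := hN n hn
        have h1 := hN (n + 1) (by omega)
        have e := quotient_succ_sub (y := ψ (m + 1)) (offDiag_pos ha n).ne'
          (show u n ≠ 0 by linarith [h0.1]) (show u (n + 1) ≠ 0 by linarith [h1.1])
        rw [sub_eq_iff_eq_add] at e
        have hden : 1 / 8 ≤ offDiag a n * u n * u (n + 1) := by
          have := mul_le_mul (mul_le_mul h0.2 h0.1 (by norm_num) (by linarith [h0.2])) h1.1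
            (by norm_num) (mul_nonneg (by linarith [h0.2]) (by linarith [h0.1]))
          linarith
        have hq : |wronskian (offDiag a) (ψ (m + 1)) u n / (offDiag a n * u n * u (n + 1))|
            ≤ 8 * U * ∑ i ∈ Finset.range (n + 1), |ψ m i| := by
          rw [abs_div, abs_of_pos (a := _ * _) (by linarith), div_le_iff₀ (by linarith)]
          refine (hW n).trans ?_
          have := mul_le_mul_of_nonneg_left hden
            (mul_nonneg (by positivity : (0 : ℝ) ≤ 8 * U) (hS0 m (n + 1)))
          linarith
        have hmono : 8 * U * n * ∑ i ∈ Finset.range n, |ψ m i|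
            ≤ 8 * U * n * ∑ i ∈ Finset.range (n + 1), |ψ m i| := by
          refine mul_le_mul_of_nonneg_left ?_ (by positivity)
          rw [Finset.sum_range_succ]
          exact le_add_of_nonneg_right (abs_nonneg _)
        rw [e]
        refine (abs_add_le _ _).trans ?_
        push_cast
        linarith
    intro n
    rcases le_total n N with hn | hn
    · rw [show ψ (m + 1) n = 0 from taylorCoeff_eq_zero a b (hn.trans hm), abs_zero]
      exact mul_nonneg (by positivity) (hS0 _ _)
    · have hne : u n ≠ 0 := by linarith [(hN n hn).1]
      rw [← div_mul_cancel₀ (ψ (m + 1) n) hne, abs_mul]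
      refine (mul_le_mul (hr n hn) (hU n) (abs_nonneg _)
        (mul_nonneg (by positivity) (hS0 _ _))).trans_eq ?_
      ring
  have hc : ∀ m, ∃ c : ℝ, 0 ≤ c ∧ ∀ n : ℕ, |ψ m n| ≤ c * (n : ℝ) ^ (2 * m + δ) := by
    intro m
    obtain ⟨c, hc⟩ := (h m).abs.bddAbove_range
    refine ⟨c, (abs_nonneg _).trans (hc ⟨0, rfl⟩), fun n => ?_⟩
    rcases Nat.eq_zero_or_pos n with rfl | hn
    · have : 0 ≤ c := (abs_nonneg _).trans (hc ⟨0, rfl⟩)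
      simp only [ψ, taylorCoeff, abs_zero]
      positivity
    · have hpos : (0 : ℝ) < (n : ℝ) ^ (2 * m + δ) := by positivity
      have := hc ⟨n, rfl⟩
      simp only [abs_div, abs_of_pos hpos] at this
      exact (div_le_iff₀ hpos).1 this
  choose c hc0 hc using hc
  set K : ℝ := 8 * U ^ 2
  have hK : 0 < K := by positivity
  -- Each order has its own constant `c m`. The sum `C` absorbs the orders `m ≤ N`; once `N ≤ m +
  -- 1`, `hstep` supplies a factor `K/(m+1)` per order.
  set C : ℝ := ∑ m ∈ Finset.range (N + 1), c m * m.factorial / K ^ m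
  have hC0 : 0 ≤ C := Finset.sum_nonneg fun m _ => by have := hc0 m; positivity
  refine ⟨C, K, hC0, hK.le, fun m => ?_⟩
  induction m with
  | zero =>
    intro n
    refine (hc 0 n).trans (mul_le_mul_of_nonneg_right ?_ (by positivity))
    have := Finset.single_le_sum (f := fun m => c m * m.factorial / K ^ m)
      (fun m _ => by have := hc0 m; positivity) (Finset.mem_range.2 (Nat.succ_pos N))
    simpa using this
  | succ m ih =>
    intro n
    by_cases hm : N ≤ m + 1
    · refine (hstep m hm n).trans ?_
      have h1 : ∑ i ∈ Finset.range n, |ψ m i|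
          ≤ C * K ^ m / m.factorial * ∑ i ∈ Finset.range n, (i : ℝ) ^ (2 * m + δ) := by
        rw [Finset.mul_sum]
        exact Finset.sum_le_sum fun i _ => ih i
      -- Summing the power gains `1/(2m+δ+1)`, at most `1/(m+1)`; this produces the factorial.
      have h2 : ((m : ℝ) + 1) * ∑ i ∈ Finset.range n, (i : ℝ) ^ (2 * m + δ)
          ≤ (n : ℝ) ^ (2 * m + δ + 1) := by
        refine le_trans ?_ (sum_range_pow_le (2 * m + δ) n)
        refine mul_le_mul_of_nonneg_right ?_ (Finset.sum_nonneg fun i _ => by positivity)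
        exact_mod_cast (by omega : m + 1 ≤ 2 * m + δ + 1)
      have h3 : ∑ i ∈ Finset.range n, (i : ℝ) ^ (2 * m + δ)
          ≤ (n : ℝ) ^ (2 * m + δ + 1) / (m + 1) := by
        rw [le_div_iff₀ (by positivity)]
        linarith
      calc K * n * ∑ i ∈ Finset.range n, |ψ m i|
          ≤ K * n * (C * K ^ m / m.factorial * ((n : ℝ) ^ (2 * m + δ + 1) / (m + 1))) := by
            refine mul_le_mul_of_nonneg_left (h1.trans ?_) (by positivity)
            exact mul_le_mul_of_nonneg_left h3 (by positivity)
        _ = C * K ^ (m + 1) / (m + 1).factorial * (n : ℝ) ^ (2 * (m + 1) + δ) := by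
            rw [Nat.factorial_succ, show 2 * (m + 1) + δ = 2 * m + δ + 1 + 1 by ring]
            push_cast
            have : (m.factorial : ℝ) ≠ 0 := by positivity
            field_simp
            ring
    · refine (hc (m + 1) n).trans (mul_le_mul_of_nonneg_right ?_ (by positivity))
      have := Finset.single_le_sum (f := fun m => c m * m.factorial / K ^ m)
        (fun m _ => by have := hc0 m; positivity)
        (Finset.mem_range.2 (show m + 1 < N + 1 by omega))
      rw [le_div_iff₀ (by positivity), ← div_le_iff₀ (by positivity)]
      exact this

end OPRL

namespace OPRL

/-! ### Convergence of zeros under convergence with derivatives -/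

/-- Uniform approximations of a continuous function without zeros on a compact set eventually have
its sign there. -/
lemma eventually_forall_mul_pos {F : ℕ → ℝ → ℝ} {g : ℝ → ℝ} {s : Set ℝ} (hs : IsCompact s)
    (hg : Continuous g) (hF : TendstoUniformlyOn F g atTop s) (h0 : ∀ x ∈ s, g x ≠ 0) :
    ∀ᶠ k in atTop, ∀ x ∈ s, 0 < g x * F k x := by
  rcases s.eq_empty_or_nonempty with rfl | hne
  · simp
  obtain ⟨x₀, hx₀, hmin⟩ := hs.exists_isMinOn hne hg.abs.continuousOn
  filter_upwards [Metric.tendstoUniformlyOn_iff.1 hF _ (abs_pos.2 (h0 x₀ hx₀))] with k hk x hx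
  have h1 : dist (g x) (F k x) < |g x| := (hk x hx).trans_le (hmin hx)
  rw [Real.dist_eq] at h1
  rcases lt_or_gt_of_ne (h0 x hx) with h | h
  · rw [abs_of_neg h, abs_lt] at h1
    exact mul_pos_of_neg_of_neg h (by linarith)
  · rw [abs_of_pos h, abs_lt] at h1
    exact mul_pos h (by linarith)

/-- Near a simple zero of the limit there is eventually exactly one zero. -/
lemma eventually_existsUnique_zero {F F' : ℕ → ℝ → ℝ} {g g' : ℝ → ℝ} {τ r : ℝ} (hr : 0 < r)
    (hFd : ∀ k x, HasDerivAt (F k) (F' k x) x) (hgd : ∀ x, HasDerivAt g (g' x) x)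
    (hg' : Continuous g')
    (hF : TendstoUniformlyOn F g atTop (Set.Icc (τ - r) (τ + r)))
    (hF' : TendstoUniformlyOn F' g' atTop (Set.Icc (τ - r) (τ + r)))
    (h0 : g τ = 0) (hne : ∀ x ∈ Set.Icc (τ - r) (τ + r), g' x ≠ 0) :
    ∀ᶠ k in atTop, ∃! x, x ∈ Set.Icc (τ - r) (τ + r) ∧ F k x = 0 := by
  have hgc : Continuous g := continuous_iff_continuousAt.2 fun x => (hgd x).continuousAt
  have hne' : ∀ x ∈ ({τ - r, τ + r} : Set ℝ), g x ≠ 0 := by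
    rintro x hx hx0
    rcases hx with rfl | rfl
    · obtain ⟨c, hc, hc0⟩ := exists_hasDerivAt_eq_zero (f := g) (f' := g')
        (show τ - r < τ by linarith) hgc.continuousOn (hx0.trans h0.symm) (fun x _ => hgd x)
      exact hne c ⟨hc.1.le, by linarith [hc.2]⟩ hc0
    · obtain ⟨c, hc, hc0⟩ := exists_hasDerivAt_eq_zero (f := g) (f' := g')
        (show τ < τ + r by linarith) hgc.continuousOn (h0.trans hx0.symm) (fun x _ => hgd x)
      exact hne c ⟨by linarith [hc.1], hc.2.le⟩ hc0
  have hsub : ({τ - r, τ + r} : Set ℝ) ⊆ Set.Icc (τ - r) (τ + r) := by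
    rintro x (rfl | rfl)
    · exact ⟨le_rfl, by linarith⟩
    · exact ⟨by linarith, le_rfl⟩
  -- Otherwise the mean slopes on the two sides of `τ` would have product at most zero, and `g'`
  -- would vanish in between.
  have hsign : g (τ - r) * g (τ + r) < 0 := by
    by_contra hcon
    obtain ⟨c, hc, e⟩ := exists_hasDerivAt_eq_slope g g' (show τ - r < τ by linarith)
      hgc.continuousOn (fun x _ => hgd x)
    obtain ⟨d, hd, e'⟩ := exists_hasDerivAt_eq_slope g g' (show τ < τ + r by linarith)
      hgc.continuousOn (fun x _ => hgd x)
    rw [h0] at e e'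
    have h3 : g' c * g' d = -(g (τ - r) * g (τ + r)) / r ^ 2 := by
      rw [e, e', sub_sub_cancel, add_sub_cancel_left]
      field_simp
      ring
    have h4 : g' c * g' d ≤ 0 := by
      rw [h3]
      exact div_nonpos_of_nonpos_of_nonneg (by linarith [not_lt.1 hcon]) (by positivity)
    have h5 : (0 : ℝ) ∈ g' '' Set.uIcc c d := by
      refine intermediate_value_uIcc hg'.continuousOn ?_
      rw [Set.mem_uIcc]
      rcases mul_nonpos_iff.1 h4 with h | h
      · exact Or.inr ⟨h.2, h.1⟩
      · exact Or.inl h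
    obtain ⟨x, hx, hx0⟩ := h5
    rw [Set.uIcc_of_le (hc.2.trans hd.1).le] at hx
    exact hne x ⟨by linarith [hx.1, hc.1], by linarith [hx.2, hd.2]⟩ hx0
  filter_upwards [eventually_forall_mul_pos (isCompact_Icc) hg' hF' hne,
    eventually_forall_mul_pos (Set.toFinite _).isCompact hgc (hF.mono hsub) hne'] with k h1 h2
  have hFc : Continuous (F k) := continuous_iff_continuousAt.2 fun x => (hFd k x).continuousAt
  refine existsUnique_of_exists_of_unique ?_ ?_
  · have ha := h2 (τ - r) (by simp)
    have hb := h2 (τ + r) (by simp)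
    have hab : F k (τ - r) * F k (τ + r) ≤ 0 := by
      by_contra hcon
      nlinarith [mul_pos ha hb, mul_neg_of_neg_of_pos hsign (not_le.1 hcon)]
    have h5 : (0 : ℝ) ∈ F k '' Set.uIcc (τ - r) (τ + r) := by
      refine intermediate_value_uIcc hFc.continuousOn ?_
      rw [Set.mem_uIcc]
      rcases mul_nonpos_iff.1 hab with h | h
      · exact Or.inr ⟨h.2, h.1⟩
      · exact Or.inl h
    rw [Set.uIcc_of_le (by linarith)] at h5
    exact h5
  · have hlt : ∀ x y, x ∈ Set.Icc (τ - r) (τ + r) → y ∈ Set.Icc (τ - r) (τ + r) →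
        F k x = 0 → F k y = 0 → ¬ x < y := by
      intro x y hx hy hx0 hy0 hxy
      obtain ⟨c, hc, hc0⟩ := exists_hasDerivAt_eq_zero (f := F k) (f' := F' k) hxy
        hFc.continuousOn (hx0.trans hy0.symm) (fun x _ => hFd k x)
      have := h1 c ⟨hx.1.trans hc.1.le, hc.2.le.trans hy.2⟩
      rw [hc0, mul_zero] at this
      exact this.false
    rintro x y ⟨hx, hx0⟩ ⟨hy, hy0⟩
    exact le_antisymm (not_lt.1 (hlt y x hy hx hy0 hx0)) (not_lt.1 (hlt x y hx hy hx0 hy0))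

/-- If functions converge together with their derivatives, and the zeros on `[0, ∞)` of the limit
are positive, simple and listed increasingly by `τ`, then the zeros of the approximations on
`[0, ∞)`, counted from `0`, converge to those of the limit. -/
lemma eventually_exists_nth_zero {F F' : ℕ → ℝ → ℝ} {g g' : ℝ → ℝ} {τ : ℕ → ℝ}
    (hFd : ∀ k x, HasDerivAt (F k) (F' k x) x) (hgd : ∀ x, HasDerivAt g (g' x) x)
    (hg' : Continuous g')
    (hF : ∀ R, TendstoUniformlyOn F g atTop (Set.Icc (-R) R))
    (hF' : ∀ R, TendstoUniformlyOn F' g' atTop (Set.Icc (-R) R))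
    (hτ : StrictMono τ) (hτ0 : 0 < τ 0) (hzero : ∀ x, 0 ≤ x → (g x = 0 ↔ ∃ i, τ i = x))
    (hsimple : ∀ i, g' (τ i) ≠ 0) (j : ℕ) {ε : ℝ} (hε : 0 < ε) :
    ∀ᶠ k in atTop, ∃ t, |t - τ j| < ε ∧ 0 ≤ t ∧ F k t = 0 ∧
      {s | 0 ≤ s ∧ F k s = 0 ∧ s ≤ t}.ncard = j + 1 := by
  have hgc : Continuous g := continuous_iff_continuousAt.2 fun x => (hgd x).continuousAt
  have hpos : ∀ i, 0 < τ i := fun i => hτ0.trans_le (hτ.monotone (Nat.zero_le i))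
  -- The radius keeps `g'` nonzero near each zero, separates neighbouring intervals, and keeps them
  -- in `x > 0` and within `ε` of their centres.
  have hr1 : ∀ i, ∀ᶠ r in 𝓝[>] (0 : ℝ), (∀ x ∈ Set.Icc (τ i - r) (τ i + r), g' x ≠ 0) ∧
      2 * r < τ (i + 1) - τ i ∧ r < τ 0 ∧ r < ε := by
    intro i
    obtain ⟨d, hd, hball⟩ := Metric.eventually_nhds_iff.1 (hg'.continuousAt.eventually_ne (hsimple i))
    have hgap : 0 < (τ (i + 1) - τ i) / 2 := by linarith [hτ (Nat.lt_succ_self i)]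
    filter_upwards [Ioo_mem_nhdsGT hd, Ioo_mem_nhdsGT hgap, Ioo_mem_nhdsGT hτ0,
      Ioo_mem_nhdsGT hε] with r h1 h2 h3 h4
    refine ⟨fun x hx => hball ?_, by linarith [h2.2], h3.2, h4.2⟩
    rw [Real.dist_eq, abs_lt]
    constructor <;> linarith [hx.1, hx.2, h1.2]
  obtain ⟨r, hr, hr0⟩ : ∃ r : ℝ, (∀ i ∈ Finset.range (j + 1),
      (∀ x ∈ Set.Icc (τ i - r) (τ i + r), g' x ≠ 0) ∧
      2 * r < τ (i + 1) - τ i ∧ r < τ 0 ∧ r < ε) ∧ 0 < r :=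
    (((Finset.eventually_all _).2 fun i _ => hr1 i).and self_mem_nhdsWithin).exists
  have hr : ∀ i, i ≤ j → _ := fun i hi => hr i (Finset.mem_range.2 (by omega))
  have hsub : ∀ i, i ≤ j → Set.Icc (τ i - r) (τ i + r) ⊆ Set.Icc (-(τ j + r)) (τ j + r) := by
    intro i hi x hx
    have h1 := hτ.monotone hi
    exact ⟨by linarith [hx.1, hpos i, hpos j], by linarith [hx.2]⟩
  have hex : ∀ᶠ k in atTop, ∀ i ∈ Finset.range (j + 1),
      ∃! x, x ∈ Set.Icc (τ i - r) (τ i + r) ∧ F k x = 0 := by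
    refine (Finset.eventually_all _).2 fun i hi => ?_
    have hi : i ≤ j := by have := Finset.mem_range.1 hi; omega
    exact eventually_existsUnique_zero hr0 hFd hgd hg' ((hF _).mono (hsub i hi))
      ((hF' _).mono (hsub i hi)) ((hzero _ (hpos i).le).2 ⟨i, rfl⟩) (hr i hi).1
  -- On the compact remainder of `[0, τ j + r]` the limit has no zero, so eventually neither does `F
  -- k`; hence the zeros up to `z j` are exactly `z 0, …, z j`.
  let Z : Set ℝ := Set.Icc 0 (τ j + r) \ ⋃ i ∈ Finset.range (j + 1), Set.Ioo (τ i - r) (τ i + r)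
  have hZc : IsCompact Z :=
    isCompact_Icc.diff (isOpen_biUnion fun i _ => isOpen_Ioo)
  have hZ0 : ∀ x ∈ Z, g x ≠ 0 := by
    rintro x ⟨hx, hx'⟩ h0
    obtain ⟨i, rfl⟩ := (hzero x hx.1).1 h0
    refine hx' (Set.mem_biUnion (x := i) ?_ ⟨by linarith, by linarith⟩)
    by_contra hi
    have hi : j + 1 ≤ i := by
      have : ¬ i < j + 1 := fun h => hi (Finset.mem_coe.2 (Finset.mem_range.2 h))
      omega
    linarith [hτ.monotone hi, (hr j le_rfl).2.1, hx.2]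
  have hZF := eventually_forall_mul_pos hZc hgc ((hF (τ j + r)).mono fun x hx =>
    ⟨by linarith [hx.1.1, hpos j], hx.1.2⟩) hZ0
  filter_upwards [hex, hZF] with k hk hkZ
  have hk : ∀ i, i ≤ j → _ := fun i hi => hk i (Finset.mem_range.2 (by omega))
  choose! z hz using fun i (hi : i ≤ j) => (hk i hi).exists
  have hsep : ∀ i i', i < i' → i' ≤ j → z i < z i' := by
    intro i i' h h'
    have h1 := (hz i (by omega)).1.2
    have h2 := (hz i' h').1.1
    linarith [hτ.monotone (show i + 1 ≤ i' from h), (hr i (by omega)).2.1]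
  have hzpos : ∀ i, i ≤ j → 0 ≤ z i := fun i hi => by
    linarith [(hz i hi).1.1, (hr i hi).2.2.1, hτ.monotone (Nat.zero_le i)]
  have hset : {s | 0 ≤ s ∧ F k s = 0 ∧ s ≤ z j} = z '' (Finset.range (j + 1) : Set ℕ) := by
    ext s
    constructor
    · rintro ⟨hs0, hsF, hsz⟩
      have hsZ : s ∉ Z := fun hs => by
        have := hkZ s hs
        rw [hsF, mul_zero] at this
        exact this.false
      have hs1 : s ∈ Set.Icc 0 (τ j + r) := ⟨hs0, hsz.trans (hz j le_rfl).1.2⟩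
      have hs2 : s ∈ ⋃ i ∈ Finset.range (j + 1), Set.Ioo (τ i - r) (τ i + r) := by
        by_contra h
        exact hsZ ⟨hs1, h⟩
      simp only [Set.mem_iUnion] at hs2
      obtain ⟨i, hi, hs⟩ := hs2
      have hi' : i ≤ j := by have := Finset.mem_range.1 hi; omega
      exact ⟨i, hi, (hk i hi').unique (hz i hi') ⟨⟨hs.1.le, hs.2.le⟩, hsF⟩⟩
    · rintro ⟨i, hi, rfl⟩
      have hi' : i ≤ j := by have := Finset.mem_range.1 (Finset.mem_coe.1 hi); omega
      refine ⟨hzpos i hi', (hz i hi').2, ?_⟩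
      rcases hi'.eq_or_lt with rfl | h
      · exact le_rfl
      · exact (hsep i j h le_rfl).le
  refine ⟨z j, ?_, hzpos j le_rfl, (hz j le_rfl).2, ?_⟩
  · rw [abs_lt]
    have := (hz j le_rfl).1
    constructor <;> linarith [this.1, this.2, (hr j le_rfl).2.2.2]
  · rw [hset, Set.InjOn.ncard_image, Set.ncard_coe_finset, Finset.card_range]
    intro i hi i' hi' h
    have hi : i ≤ j := by have := Finset.mem_range.1 (Finset.mem_coe.1 hi); omega
    have hi' : i' ≤ j := by have := Finset.mem_range.1 (Finset.mem_coe.1 hi'); omega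
    rcases lt_trichotomy i i' with hlt | heq | hlt
    · exact absurd h (hsep i i' hlt hi').ne
    · exact heq
    · exact absurd h (hsep i' i hlt hi).ne'

/-- Polynomials with convergent, uniformly rapidly decaying coefficients converge locally
uniformly. -/
lemma tendstoUniformlyOn_eval {P : ℕ → Polynomial ℝ} {d : ℕ → ℝ} {C K : ℝ}
    (hC : ∀ k m, |(P k).coeff m| ≤ C * K ^ m / (m.factorial : ℝ))
    (hd : ∀ m, Tendsto (fun k => (P k).coeff m) atTop (𝓝 (d m))) (R : ℝ) :
    TendstoUniformlyOn (fun k x => (P k).eval x) (fun x => ∑' m, d m * x ^ m) atTop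
      (Set.Icc (-R) R) := by
  have hdC : ∀ m, |d m| ≤ C * K ^ m / (m.factorial : ℝ) := fun m =>
    le_of_tendsto (hd m).abs (Eventually.of_forall fun k => hC k m)
  have hs : ∀ x : ℝ, Summable fun m => C * K ^ m / (m.factorial : ℝ) * |x| ^ m := fun x => by
    refine ((Real.summable_pow_div_factorial (K * |x|)).mul_left C).congr fun m => ?_
    rw [mul_pow]
    ring
  have hP : ∀ k x, HasSum (fun m => (P k).coeff m * x ^ m) ((P k).eval x) := fun k x => by
    rw [Polynomial.eval_eq_sum_range]
    refine hasSum_sum_of_ne_finset_zero fun m hm => ?_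
    rw [Polynomial.coeff_eq_zero_of_natDegree_lt, zero_mul]
    simpa using hm
  have hds : ∀ x : ℝ, Summable fun m => d m * x ^ m := fun x =>
    (hs x).of_norm_bounded fun m => by
      rw [Real.norm_eq_abs, abs_mul, abs_pow]
      exact mul_le_mul_of_nonneg_right (hdC m) (by positivity)
  -- The sum of `|coefficient difference| * |R|^m` dominates the error on all of `[-R, R]`, and
  -- tends to zero by dominated convergence.
  have hlim : Tendsto (fun k => ∑' m, |(P k).coeff m - d m| * |R| ^ m) atTop
      (𝓝 (∑' _ : ℕ, (0 : ℝ))) := by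
    refine tendsto_tsum_of_dominated_convergence ((hs R).mul_left 2) (fun m => ?_)
      (Eventually.of_forall fun k m => ?_)
    · have := (((hd m).sub_const (d m)).abs).mul_const (|R| ^ m)
      simpa using this
    · rw [Real.norm_eq_abs, abs_mul, abs_abs, abs_pow, abs_abs, ← mul_assoc]
      refine mul_le_mul_of_nonneg_right ?_ (by positivity)
      refine (abs_sub _ _).trans ?_
      linarith [hC k m, hdC m]
  have hsum : ∀ k, Summable fun m => |(P k).coeff m - d m| * |R| ^ m := fun k =>
    ((hs R).mul_left 2).of_norm_bounded fun m => by
      rw [Real.norm_eq_abs, abs_mul, abs_abs, abs_pow, abs_abs, ← mul_assoc]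
      refine mul_le_mul_of_nonneg_right ?_ (by positivity)
      refine (abs_sub _ _).trans ?_
      linarith [hC k m, hdC m]
  rw [tsum_zero] at hlim
  rw [Metric.tendstoUniformlyOn_iff]
  intro ε hε
  filter_upwards [hlim.eventually (gt_mem_nhds hε)] with k hk x hx
  refine lt_of_le_of_lt ?_ hk
  rw [dist_comm, Real.dist_eq, ← (hP k x).tsum_eq, ← (hP k x).summable.tsum_sub (hds x),
    ← Real.norm_eq_abs]
  refine tsum_of_norm_bounded (hsum k).hasSum fun m => ?_
  rw [← sub_mul, Real.norm_eq_abs, abs_mul, abs_pow]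
  refine mul_le_mul_of_nonneg_left ?_ (abs_nonneg _)
  exact pow_le_pow_left₀ (abs_nonneg _) ((abs_le.2 hx).trans (le_abs_self R)) m

end OPRL

namespace OPRL

/-- Differentiation preserves the form of the bound, since `K^(m+1) (m+1)/(m+1)! = K * K^m/m!`. -/
lemma tendstoUniformlyOn_eval_derivative {P : ℕ → Polynomial ℝ} {d : ℕ → ℝ} {C K : ℝ}
    (hC : ∀ k m, |(P k).coeff m| ≤ C * K ^ m / (m.factorial : ℝ))
    (hd : ∀ m, Tendsto (fun k => (P k).coeff m) atTop (𝓝 (d m))) (R : ℝ) :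
    TendstoUniformlyOn (fun k x => (P k).derivative.eval x)
      (fun x => ∑' m, d (m + 1) * (m + 1) * x ^ m) atTop (Set.Icc (-R) R) := by
  refine tendstoUniformlyOn_eval (d := fun m => d (m + 1) * (m + 1)) (C := C * K) (K := K)
    (fun k m => ?_) (fun m => ?_) R
  · have hm : (0 : ℝ) < (m : ℝ) + 1 := by positivity
    rw [Polynomial.coeff_derivative, abs_mul, abs_of_pos hm]
    refine (mul_le_mul_of_nonneg_right (hC k (m + 1)) hm.le).trans_eq ?_
    rw [Nat.factorial_succ]
    push_cast
    have : (m.factorial : ℝ) ≠ 0 := by positivity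
    field_simp
    ring
  · simp only [Polynomial.coeff_derivative]
    exact (hd (m + 1)).mul_const _

/-- Convergence of the zeros of polynomials whose coefficients converge and decay rapidly. -/
lemma eventually_exists_nth_zero_of_coeff {P : ℕ → Polynomial ℝ} {d : ℕ → ℝ} {C K : ℝ}
    (hC : ∀ k m, |(P k).coeff m| ≤ C * K ^ m / (m.factorial : ℝ))
    (hd : ∀ m, Tendsto (fun k => (P k).coeff m) atTop (𝓝 (d m))) {τ : ℕ → ℝ}
    (hτ : StrictMono τ) (hτ0 : 0 < τ 0)
    (hzero : ∀ x, 0 ≤ x → (∑' m, d m * x ^ m = 0 ↔ ∃ i, τ i = x))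
    (hsimple : ∀ i, ∃ e, e ≠ 0 ∧ HasDerivAt (fun x => ∑' m, d m * x ^ m) e (τ i))
    (j : ℕ) {ε : ℝ} (hε : 0 < ε) :
    ∀ᶠ k in atTop, ∃ t, |t - τ j| < ε ∧ 0 ≤ t ∧ (P k).eval t = 0 ∧
      {s | 0 ≤ s ∧ (P k).eval s = 0 ∧ s ≤ t}.ncard = j + 1 := by
  have hF := tendstoUniformlyOn_eval hC hd
  have hF' := tendstoUniformlyOn_eval_derivative hC hd
  have hloc : TendstoLocallyUniformly (fun k x => (P k).derivative.eval x)
      (fun x => ∑' m, d (m + 1) * (m + 1) * x ^ m) atTop := by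
    rw [tendstoLocallyUniformly_iff_forall_isCompact]
    intro s hs
    obtain ⟨R, hR⟩ := hs.isBounded.subset_closedBall 0
    rw [Real.closedBall_eq_Icc, zero_sub, zero_add] at hR
    exact (hF' R).mono hR
  have hFd : ∀ k x, HasDerivAt (fun x => (P k).eval x) ((P k).derivative.eval x) x :=
    fun k x => (P k).hasDerivAt x
  have hgd : ∀ x, HasDerivAt (fun x => ∑' m, d m * x ^ m)
      (∑' m, d (m + 1) * (m + 1) * x ^ m) x := fun x =>
    hasDerivAt_of_tendstoLocallyUniformlyOn isOpen_univ (tendstoLocallyUniformlyOn_univ.2 hloc)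
      (Eventually.of_forall fun k x _ => hFd k x)
      (fun x _ => (hF |x|).tendsto_at (abs_le.1 le_rfl)) (Set.mem_univ x)
  refine eventually_exists_nth_zero hFd hgd
    (hloc.continuous (Eventually.of_forall fun k => (P k).derivative.continuous).frequently)
    hF hF' hτ hτ0 hzero (fun i => ?_) j hε
  obtain ⟨e, he, hde⟩ := hsimple i
  rwa [(hgd _).unique hde]

/-! ### Scaled polynomials and the passage to angles -/

/-- The orthonormal polynomial of degree `n` in the scaled variable `t`, where `x = 2 - t/(n+1)²`. -/
noncomputable def scaledPoly (a b : ℕ → ℝ) (δ n : ℕ) : Polynomial ℝ :=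
  Polynomial.C (((n : ℝ) + 1) ^ δ)⁻¹ * (Polynomial.taylor 2 (orthoPoly a b n)).comp
    (Polynomial.C (-(((n : ℝ) + 1) ^ 2)⁻¹) * Polynomial.X)

lemma coeff_scaledPoly (a b : ℕ → ℝ) (δ n m : ℕ) : (scaledPoly a b δ n).coeff m =
    (-1) ^ m * (taylorCoeff a b m (n + 1) / ((n + 1 : ℕ) : ℝ) ^ (2 * m + δ)) := by
  rw [scaledPoly, Polynomial.coeff_C_mul, Polynomial.comp_C_mul_X_coeff, neg_pow, inv_pow,
    ← pow_mul, pow_add]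
  simp only [taylorCoeff]
  push_cast
  field_simp

lemma eval_scaledPoly_eq_zero_iff (a b : ℕ → ℝ) (δ n : ℕ) (t : ℝ) :
    (scaledPoly a b δ n).eval t = 0 ↔
      (orthoPoly a b n).eval (2 - t / ((n : ℝ) + 1) ^ 2) = 0 := by
  rw [scaledPoly, Polynomial.eval_mul, Polynomial.eval_C, Polynomial.eval_comp,
    Polynomial.taylor_eval, mul_eq_zero_iff_left (by positivity)]
  simp only [Polynomial.eval_mul, Polynomial.eval_C, Polynomial.eval_X]
  rw [show -(((n : ℝ) + 1) ^ 2)⁻¹ * t + 2 = 2 - t / ((n : ℝ) + 1) ^ 2 by ring]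

/-- A zero in the scaled variable, counted from `0`, gives a zero angle. -/
lemma exists_isZeroAngle {a b : ℕ → ℝ} {δ n j : ℕ} {t : ℝ} (ht0 : 0 ≤ t)
    (ht1 : t ≤ 4 * ((n : ℝ) + 1) ^ 2) (ht : (scaledPoly a b δ n).eval t = 0)
    (hcard : {s | 0 ≤ s ∧ (scaledPoly a b δ n).eval s = 0 ∧ s ≤ t}.ncard = j) :
    ∃ θ, IsZeroAngle a b n j θ ∧ ((n : ℝ) + 1) ^ 2 * (2 - 2 * Real.cos θ) = t := by
  have hn : (0 : ℝ) < ((n : ℝ) + 1) ^ 2 := by positivity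
  let φ : ℝ → ℝ := fun θ => ((n : ℝ) + 1) ^ 2 * (2 - 2 * Real.cos θ)
  have hφ : ∀ θ, 2 - φ θ / ((n : ℝ) + 1) ^ 2 = 2 * Real.cos θ := fun θ => by
    simp only [φ]
    rw [mul_div_cancel_left₀ _ hn.ne']
    ring
  have hmem : ∀ θ, (orthoPoly a b n).eval (2 * Real.cos θ) = 0 ↔
      (scaledPoly a b δ n).eval (φ θ) = 0 := fun θ => by
    rw [eval_scaledPoly_eq_zero_iff, hφ]
  have hsurj : ∀ s, 0 ≤ s → s ≤ 4 * ((n : ℝ) + 1) ^ 2 →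
      ∃ θ ∈ Set.Icc 0 Real.pi, φ θ = s := by
    intro s hs0 hs1
    have h0 : 0 ≤ s / ((n : ℝ) + 1) ^ 2 := by positivity
    have h1 : s / ((n : ℝ) + 1) ^ 2 ≤ 4 := by rwa [div_le_iff₀ hn]
    refine ⟨Real.arccos (1 - s / ((n : ℝ) + 1) ^ 2 / 2),
      ⟨Real.arccos_nonneg _, Real.arccos_le_pi _⟩, ?_⟩
    simp only [φ]
    rw [Real.cos_arccos (by linarith) (by linarith)]
    field_simp
    ring
  have hle : ∀ θ ∈ Set.Icc 0 Real.pi, ∀ θ' ∈ Set.Icc 0 Real.pi, φ θ ≤ φ θ' ↔ θ ≤ θ' := by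
    intro θ hθ θ' hθ'
    rw [← Real.strictAntiOn_cos.le_iff_ge hθ' hθ]
    simp only [φ]
    rw [mul_le_mul_iff_right₀ hn]
    constructor <;> intro h <;> linarith
  have hinj : Set.InjOn φ (Set.Icc 0 Real.pi) := fun θ hθ θ' hθ' h =>
    le_antisymm ((hle θ hθ θ' hθ').1 h.le) ((hle θ' hθ' θ hθ).1 h.ge)
  obtain ⟨θ, hθ, rfl⟩ := hsurj t ht0 ht1
  refine ⟨θ, ⟨⟨hθ, (hmem θ).2 ht⟩, ?_⟩, rfl⟩
  have himg : {s | 0 ≤ s ∧ (scaledPoly a b δ n).eval s = 0 ∧ s ≤ φ θ}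
      = φ '' {s ∈ zeroAngles a b n | s ≤ θ} := by
    ext s
    constructor
    · rintro ⟨hs0, hs, hst⟩
      obtain ⟨η, hη, rfl⟩ := hsurj s hs0 (hst.trans ht1)
      exact ⟨η, ⟨⟨hη, (hmem η).2 hs⟩, (hle η hη θ hθ).1 hst⟩, rfl⟩
    · rintro ⟨η, ⟨⟨hη, h⟩, hηθ⟩, rfl⟩
      refine ⟨?_, (hmem η).1 h, (hle η hη θ hθ).2 hηθ⟩
      exact mul_nonneg hn.le (by linarith [Real.cos_le_one η])
  rw [himg, Set.InjOn.ncard_image (hinj.mono fun s hs => hs.1.1)] at hcard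
  exact hcard

/-- The `j`-th zero angle is unique. -/
lemma IsZeroAngle.unique {a b : ℕ → ℝ} {n j : ℕ} (hj : 1 ≤ j) {s t : ℝ}
    (hs : IsZeroAngle a b n j s) (ht : IsZeroAngle a b n j t) : s = t := by
  have key : ∀ s t, IsZeroAngle a b n j s → IsZeroAngle a b n j t → ¬ s < t := by
    intro s t hs ht hst
    -- An infinite set has `ncard` equal to `0`, so `j ≥ 1` guarantees finiteness.
    have hfin : {r ∈ zeroAngles a b n | r ≤ t}.Finite :=
      Set.finite_of_ncard_ne_zero (by rw [ht.2]; omega)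
    have := Set.ncard_lt_ncard (s := {r ∈ zeroAngles a b n | r ≤ s})
      (t := {r ∈ zeroAngles a b n | r ≤ t})
      ⟨fun r hr => ⟨hr.1, hr.2.trans hst.le⟩, fun h => (h ⟨ht.1, le_rfl⟩).2.not_gt hst⟩ hfin
    rw [hs.2, ht.2] at this
    exact this.false
  exact le_antisymm (not_lt.1 (key t s ht hs)) (not_lt.1 (key s t hs ht))

/-- Small angles are recovered from their cosines. -/
lemma tendsto_nat_mul_angle {θ : ℕ → ℝ} {σ : ℝ} (hσ : 0 ≤ σ)
    (hθ : ∀ᶠ n in atTop, θ n ∈ Set.Icc 0 Real.pi)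
    (h : Tendsto (fun n : ℕ => ((n : ℝ) + 1) ^ 2 * (2 - 2 * Real.cos (θ n))) atTop (𝓝 (σ ^ 2))) :
    Tendsto (fun n : ℕ => (n : ℝ) * θ n) atTop (𝓝 σ) := by
  have htop : Tendsto (fun n : ℕ => ((n : ℝ) + 1) ^ 2) atTop atTop :=
    (tendsto_pow_atTop (two_ne_zero)).comp
      (tendsto_atTop_add_const_right _ _ tendsto_natCast_atTop_atTop)
  have hcos : Tendsto (fun n => Real.cos (θ n)) atTop (𝓝 1) := by
    have := ((h.div_atTop htop).div_const 2).const_sub 1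
    rw [zero_div, sub_zero] at this
    refine this.congr fun n => ?_
    have : ((n : ℝ) + 1) ^ 2 ≠ 0 := by positivity
    rw [mul_div_cancel_left₀ _ this]
    ring
  have hθ0 : Tendsto θ atTop (𝓝 0) := by
    have := (Real.continuous_arccos.tendsto 1).comp hcos
    rw [Real.arccos_one] at this
    refine this.congr' ?_
    filter_upwards [hθ] with n hn
    exact Real.arccos_cos hn.1 hn.2
  have hsinc : Tendsto (fun n => Real.sinc (θ n / 2)) atTop (𝓝 1) := by
    have := (Real.continuous_sinc.tendsto _).comp (hθ0.div_const 2)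
    rwa [zero_div, Real.sinc_zero] at this
  have hsqrt := (Real.continuous_sqrt.tendsto _).comp h
  rw [Real.sqrt_sq hσ] at hsqrt
  have hfrac := tendsto_natCast_div_add_atTop (1 : ℝ)
  have := (hfrac.mul hsqrt).div hsinc one_ne_zero
  rw [one_mul, div_one] at this
  refine this.congr' ?_
  filter_upwards [hθ, hsinc.eventually_ne one_ne_zero] with n hn hne
  -- The square root of the scaled quantity becomes `(n+1) θ sinc(θ/2)`, and `sinc(θ/2) → 1`.
  have hhalf : 2 - 2 * Real.cos (θ n) = (2 * Real.sin (θ n / 2)) ^ 2 := by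
    have h1 := Real.cos_sq (θ n / 2)
    rw [show 2 * (θ n / 2) = θ n by ring] at h1
    have h2 := Real.sin_sq_add_cos_sq (θ n / 2)
    linear_combination -4 * h2 + 4 * h1
  have hsin : Real.sin (θ n / 2) = θ n / 2 * Real.sinc (θ n / 2) := by
    rcases eq_or_ne (θ n / 2) 0 with h0 | h0
    · simp [h0]
    · rw [Real.sinc_of_ne_zero h0, mul_comm, div_mul_cancel₀ _ h0]
  have hsin0 : 0 ≤ Real.sin (θ n / 2) :=
    Real.sin_nonneg_of_nonneg_of_le_pi (by linarith [hn.1]) (by linarith [hn.2, hn.1])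
  have hn1 : (n : ℝ) + 1 ≠ 0 := by positivity
  simp only [Pi.div_apply, Function.comp_apply]
  rw [hhalf, ← mul_pow, Real.sqrt_sq (by positivity), hsin]
  field_simp

/-! ### The limit functions and their simple zeros -/

lemma tsum_even_sqrt (c : ℝ) {x : ℝ} (hx : 0 ≤ x) :
    ∑' m : ℕ, (-1) ^ m * (c / ((2 * m + 0).factorial : ℝ)) * x ^ m = c * Real.cos (√x) := by
  rw [← ((Real.hasSum_cos (√x)).mul_left c).tsum_eq]
  refine tsum_congr fun m => ?_
  rw [pow_mul, Real.sq_sqrt hx, add_zero]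
  ring

/-- The factor `√x` stands on the left to avoid division at `x = 0`, where the series itself equals
`c`. -/
lemma sqrt_mul_tsum_odd (c : ℝ) {x : ℝ} (hx : 0 ≤ x) :
    √x * ∑' m : ℕ, (-1) ^ m * (c / ((2 * m + 1).factorial : ℝ)) * x ^ m
      = c * Real.sin (√x) := by
  rw [← ((Real.hasSum_sin (√x)).mul_left c).tsum_eq, ← tsum_mul_left]
  refine tsum_congr fun m => ?_
  rw [pow_succ, pow_mul, Real.sq_sqrt hx]
  ring

lemma strictMono_sq_angle {κ : ℝ} (hκ : 0 < κ) :
    StrictMono fun i : ℕ => (((i : ℝ) + κ) * Real.pi) ^ 2 := by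
  refine strictMono_nat_of_lt_succ fun i => ?_
  push_cast
  have := Real.pi_pos
  gcongr
  linarith

lemma exists_sq_angle_eq_iff {κ : ℝ} (hκ : 0 < κ) {x : ℝ} (hx : 0 ≤ x) :
    (∃ i : ℕ, (((i : ℝ) + κ) * Real.pi) ^ 2 = x) ↔ ∃ i : ℕ, √x = ((i : ℝ) + κ) * Real.pi := by
  have := Real.pi_pos
  refine exists_congr fun i => ?_
  rw [Real.sqrt_eq_iff_eq_sq hx (by positivity), eq_comm]

lemma tsum_even_eq_zero_iff {c : ℝ} (hc : c ≠ 0) {x : ℝ} (hx : 0 ≤ x) :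
    ∑' m : ℕ, (-1) ^ m * (c / ((2 * m + 0).factorial : ℝ)) * x ^ m = 0 ↔
      ∃ i : ℕ, (((i : ℝ) + 1 / 2) * Real.pi) ^ 2 = x := by
  have hπ := Real.pi_pos
  rw [tsum_even_sqrt c hx, mul_eq_zero_iff_left hc, exists_sq_angle_eq_iff (by norm_num) hx,
    Real.cos_eq_zero_iff]
  constructor
  · rintro ⟨k, hk⟩
    have h0 : (0 : ℝ) ≤ 2 * k + 1 := by
      by_contra hneg
      have := mul_neg_of_neg_of_pos (not_le.1 hneg) hπ
      linarith [Real.sqrt_nonneg x]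
    have hk0 : 0 ≤ k := by
      have : (0 : ℤ) ≤ 2 * k + 1 := by exact_mod_cast h0
      omega
    lift k to ℕ using hk0
    exact ⟨k, by rw [hk]; push_cast; ring⟩
  · rintro ⟨i, hi⟩
    exact ⟨i, by rw [hi]; push_cast; ring⟩

lemma tsum_odd_eq_zero_iff {c : ℝ} (hc : c ≠ 0) {x : ℝ} (hx : 0 ≤ x) :
    ∑' m : ℕ, (-1) ^ m * (c / ((2 * m + 1).factorial : ℝ)) * x ^ m = 0 ↔
      ∃ i : ℕ, (((i : ℝ) + 1) * Real.pi) ^ 2 = x := by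
  have hπ := Real.pi_pos
  rcases hx.eq_or_lt with rfl | hx0
  · refine iff_of_false ?_ ?_
    · rw [tsum_eq_single 0 (fun m hm => by simp [hm])]
      simpa using hc
    · rintro ⟨i, hi⟩
      have : (0 : ℝ) < (((i : ℝ) + 1) * Real.pi) ^ 2 := by positivity
      exact this.ne' hi
  have hs : 0 < √x := Real.sqrt_pos.2 hx0
  rw [← mul_eq_zero_iff_left hs.ne', sqrt_mul_tsum_odd c hx, mul_eq_zero_iff_left hc,
    exists_sq_angle_eq_iff one_pos hx, Real.sin_eq_zero_iff]
  constructor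
  · rintro ⟨k, hk⟩
    have h0 : (0 : ℝ) < k := by
      rw [← hk] at hs
      exact (pos_iff_pos_of_mul_pos hs).2 hπ
    have hk0 : 0 < k := by exact_mod_cast h0
    obtain ⟨i, rfl⟩ := Int.exists_add_of_le hk0
    exact ⟨i, by rw [← hk]; push_cast; ring⟩
  · rintro ⟨i, hi⟩
    exact ⟨i + 1, by rw [hi]; push_cast; ring⟩

lemma exists_hasDerivAt_even {c : ℝ} (hc : c ≠ 0) {x : ℝ} (hx : 0 < x)
    (h0 : ∑' m : ℕ, (-1) ^ m * (c / ((2 * m + 0).factorial : ℝ)) * x ^ m = 0) :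
    ∃ e, e ≠ 0 ∧ HasDerivAt
      (fun x : ℝ => ∑' m : ℕ, (-1) ^ m * (c / ((2 * m + 0).factorial : ℝ)) * x ^ m) e x := by
  have hs : 0 < √x := Real.sqrt_pos.2 hx
  rw [tsum_even_sqrt c hx.le, mul_eq_zero_iff_left hc] at h0
  have hsin : Real.sin (√x) ≠ 0 := fun h => by
    have := Real.sin_sq_add_cos_sq (√x)
    rw [h, h0] at this
    norm_num at this
  refine ⟨c * (-Real.sin (√x) * (1 / (2 * √x))), ?_, ?_⟩
  · have : 1 / (2 * √x) ≠ 0 := by positivity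
    exact mul_ne_zero hc (mul_ne_zero (neg_ne_zero.2 hsin) this)
  · refine (((Real.hasDerivAt_cos _).comp x (Real.hasDerivAt_sqrt hx.ne')).const_mul c)
      |>.congr_of_eventuallyEq ?_
    filter_upwards [lt_mem_nhds hx] with y hy
    exact tsum_even_sqrt c hy.le

/-- For `x > 0` the series is `c sin √x / √x`; where the sine vanishes the cosine does not, and only
its term remains in the quotient rule. -/
lemma exists_hasDerivAt_odd {c : ℝ} (hc : c ≠ 0) {x : ℝ} (hx : 0 < x)
    (h0 : ∑' m : ℕ, (-1) ^ m * (c / ((2 * m + 1).factorial : ℝ)) * x ^ m = 0) :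
    ∃ e, e ≠ 0 ∧ HasDerivAt
      (fun x : ℝ => ∑' m : ℕ, (-1) ^ m * (c / ((2 * m + 1).factorial : ℝ)) * x ^ m) e x := by
  have hs : 0 < √x := Real.sqrt_pos.2 hx
  have h1 := sqrt_mul_tsum_odd c hx.le
  rw [h0, mul_zero, eq_comm, mul_eq_zero_iff_left hc] at h1
  have hcos : Real.cos (√x) ≠ 0 := fun h => by
    have := Real.sin_sq_add_cos_sq (√x)
    rw [h, h1] at this
    norm_num at this
  have hd := (((Real.hasDerivAt_sin _).comp x (Real.hasDerivAt_sqrt hx.ne')).const_mul c).div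
    (Real.hasDerivAt_sqrt hx.ne') hs.ne'
  refine ⟨_, ?_, hd.congr_of_eventuallyEq ?_⟩
  · simp only [Function.comp_apply, h1, mul_zero, zero_mul, sub_zero]
    have : 1 / (2 * √x) ≠ 0 := by positivity
    exact div_ne_zero (mul_ne_zero (mul_ne_zero hc (mul_ne_zero hcos this)) hs.ne')
      (pow_ne_zero _ hs.ne')
  · filter_upwards [lt_mem_nhds hx] with y hy
    have hy' : 0 < √y := Real.sqrt_pos.2 hy
    simp only [Pi.div_apply, Function.comp_apply]
    rw [eq_div_iff hy'.ne', mul_comm]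
    exact sqrt_mul_tsum_odd c hy.le

/-! ### Asymptotics of the zero angles -/

/-- Asymptotics of the zero angles from the growth of the Taylor coefficients at `2`; here
`δ = 0, κ = 1/2` in the resonant and `δ = κ = 1` in the nonresonant case. -/
lemma zeroAngle_asymptotics {a b u : ℕ → ℝ} (ha : ∀ n : ℕ, 1 ≤ n → 0 < a n)
    (ha1 : Tendsto (offDiag a) atTop (𝓝 1)) (hu : IsSol (offDiag a) b 0 u)
    (hu1 : Tendsto u atTop (𝓝 1)) {δ : ℕ} (hδ : δ ≤ 1) {c κ : ℝ} (hκ : 0 < κ)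
    (h0 : Tendsto (fun n : ℕ => taylorCoeff a b 0 n / (n : ℝ) ^ δ) atTop (𝓝 c))
    (hzero : ∀ x : ℝ, 0 ≤ x →
      (∑' m : ℕ, (-1) ^ m * (c / ((2 * m + δ).factorial : ℝ)) * x ^ m = 0 ↔
        ∃ i : ℕ, (((i : ℝ) + κ) * Real.pi) ^ 2 = x))
    (hsimple : ∀ x : ℝ, 0 < x →
      ∑' m : ℕ, (-1) ^ m * (c / ((2 * m + δ).factorial : ℝ)) * x ^ m = 0 →
      ∃ e, e ≠ 0 ∧ HasDerivAt
        (fun x : ℝ => ∑' m : ℕ, (-1) ^ m * (c / ((2 * m + δ).factorial : ℝ)) * x ^ m) e x)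
    (j : ℕ) :
    (∀ᶠ n : ℕ in atTop, ∃ t : ℝ, IsZeroAngle a b n (j + 1) t) ∧
      ∀ θ : ℕ → ℝ, (∀ᶠ n : ℕ in atTop, IsZeroAngle a b n (j + 1) (θ n)) →
        Tendsto (fun n : ℕ => (n : ℝ) * θ n) atTop (𝓝 (((j : ℝ) + κ) * Real.pi)) := by
  have hπ := Real.pi_pos
  have hlim := tendsto_taylorCoeff ha ha1 hu hu1 hδ h0
  obtain ⟨C, K, hC, hK, hbd⟩ := exists_abs_taylorCoeff_le ha ha1 hu hu1 hlim
  set τ : ℕ → ℝ := fun i => (((i : ℝ) + κ) * Real.pi) ^ 2 with hτdef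
  have hτpos : ∀ i, 0 < τ i := fun i => by positivity
  have hcoeff : ∀ m, Tendsto (fun n => (scaledPoly a b δ n).coeff m) atTop
      (𝓝 ((-1) ^ m * (c / ((2 * m + δ).factorial : ℝ)))) := fun m => by
    simp only [coeff_scaledPoly]
    exact ((tendsto_add_atTop_iff_nat 1).2 (hlim m)).const_mul _
  have hcoeffC : ∀ n m, |(scaledPoly a b δ n).coeff m| ≤ C * K ^ m / (m.factorial : ℝ) := by
    intro n m
    have hpos : (0 : ℝ) < ((n + 1 : ℕ) : ℝ) ^ (2 * m + δ) := by positivity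
    rw [coeff_scaledPoly, abs_mul, abs_pow, abs_neg, abs_one, one_pow, one_mul, abs_div,
      abs_of_pos hpos, div_le_iff₀ hpos]
    exact hbd m (n + 1)
  have hmain : ∀ ε : ℝ, 0 < ε → ∀ᶠ n : ℕ in atTop, ∃ θ, IsZeroAngle a b n (j + 1) θ ∧
      |((n : ℝ) + 1) ^ 2 * (2 - 2 * Real.cos θ) - τ j| < ε := by
    intro ε hε
    -- The angles in `[0, π]` reach only `t ≤ 4(n+1)²`, that is, `x ≥ -2`; for large `n` this
    -- includes a neighbourhood of `τ j`.
    have htop : Tendsto (fun n : ℕ => 4 * ((n : ℝ) + 1) ^ 2) atTop atTop :=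
      ((tendsto_pow_atTop (two_ne_zero)).comp
        (tendsto_atTop_add_const_right _ _ tendsto_natCast_atTop_atTop)).const_mul_atTop
          (by norm_num)
    filter_upwards [eventually_exists_nth_zero_of_coeff hcoeffC hcoeff (strictMono_sq_angle hκ)
      (hτpos 0) hzero (fun i => hsimple _ (hτpos i) ((hzero _ (hτpos i).le).2 ⟨i, rfl⟩)) j hε,
      htop.eventually_ge_atTop (τ j + ε)] with n ⟨t, ht, ht0, htz, htc⟩ hn
    obtain ⟨θ, hθ, rfl⟩ := exists_isZeroAngle ht0
      (by linarith [(abs_lt.1 ht).2]) htz htc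
    exact ⟨θ, hθ, ht⟩
  refine ⟨(hmain 1 one_pos).mono fun n ⟨θ, hθ, _⟩ => ⟨θ, hθ⟩, fun θ hθ => ?_⟩
  refine tendsto_nat_mul_angle (by positivity) (hθ.mono fun n hn => hn.1.1) ?_
  rw [Metric.tendsto_atTop']
  intro ε hε
  obtain ⟨N, hN⟩ := eventually_atTop.1 ((hmain ε hε).and hθ)
  refine ⟨N, fun n hn => ?_⟩
  obtain ⟨⟨η, hη, hlt⟩, hθn⟩ := hN n (le_of_lt hn)
  rw [Real.dist_eq, hθn.unique (by omega) hη]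
  exact hlt

end OPRL

theorem theorem3p8 (a b : ℕ → ℝ) (ha : ∀ n : ℕ, 1 ≤ n → 0 < a n)
    (hab : Summable fun n : ℕ => (n : ℝ) * (|a n - 1| + |b n|)) :
    -- the Jost function is well defined at `2`
    (∃! u : ℕ → ℂ, OPRL.IsJostSolution a b 1 u) ∧
    ∀ j : ℕ, 1 ≤ j →
      -- `θ_j^{(n)}` exists for all large `n`
      (∀ᶠ n : ℕ in atTop, ∃ t : ℝ, OPRL.IsZeroAngle a b n j t) ∧
      ∀ θ : ℕ → ℝ, (∀ᶠ n : ℕ in atTop, OPRL.IsZeroAngle a b n j (θ n)) →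
        (OPRL.IsResonantAtTwo a b →
          Tendsto (fun n : ℕ => (n : ℝ) * θ n) atTop (𝓝 (((j : ℝ) - 1 / 2) * Real.pi))) ∧
        (¬ OPRL.IsResonantAtTwo a b →
          Tendsto (fun n : ℕ => (n : ℝ) * θ n) atTop (𝓝 ((j : ℝ) * Real.pi))) := by
  have hA := OPRL.offDiag_pos ha
  have hA1 := OPRL.tendsto_offDiag hab
  obtain ⟨u, hu, hu1⟩ := OPRL.exists_jost hA hA1 (OPRL.summable_potential hab)
  refine ⟨⟨_, OPRL.isJostSolution_ofReal hu hu1, fun v hv => hv.eq_ofReal hA hA1 hu hu1⟩, ?_⟩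
  have hres : OPRL.IsResonantAtTwo a b ↔ u 0 = 0 := by
    rw [OPRL.IsResonantAtTwo, OPRL.jostFunction_eq_ofReal hA hA1 hu hu1, Complex.ofReal_eq_zero]
  rw [hres]
  intro j hj
  -- The zeros of the limit are indexed from `0`, the angles from `1`.
  obtain ⟨j, rfl⟩ := Nat.exists_eq_add_of_le' hj
  by_cases h0 : u 0 = 0
  · obtain ⟨c, hc, hlim⟩ := OPRL.tendsto_taylorCoeff_zero_of_eq ha hu hu1 h0
    obtain ⟨h1, h2⟩ := OPRL.zeroAngle_asymptotics ha hA1 hu hu1 (Nat.zero_le 1)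
      (show (0 : ℝ) < 1 / 2 by norm_num) hlim (fun x hx => OPRL.tsum_even_eq_zero_iff hc hx)
      (fun x hx => OPRL.exists_hasDerivAt_even hc hx) j
    refine ⟨h1, fun θ hθ => ⟨fun _ => ?_, fun h => absurd h0 h⟩⟩
    have := h2 θ hθ
    push_cast
    rwa [show (j : ℝ) + 1 - 1 / 2 = j + 1 / 2 by ring]
  · obtain ⟨h1, h2⟩ := OPRL.zeroAngle_asymptotics ha hA1 hu hu1 le_rfl one_pos
      (OPRL.tendsto_taylorCoeff_zero_of_ne ha hA1 hu hu1)
      (fun x hx => OPRL.tsum_odd_eq_zero_iff h0 hx)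
      (fun x hx => OPRL.exists_hasDerivAt_odd h0 hx) j
    refine ⟨h1, fun θ hθ => ⟨fun h => absurd h h0, fun _ => ?_⟩⟩
    have := h2 θ hθ
    push_cast
    exact this
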